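/- Let $V(z)=\sum_{k=1}^m \frac{v_k}{k}z^k$ be a real polynomial of even degree $m\ge 2$ with $v_m>0$, let $a>0$, let $n_1,n_2\ge 1$ be integers and put $N=n_1+n_2$. For $k_1,k_2\ge 0$ let $P_{k_1,k_2}$ be the monic polynomial of degree $k_1+k_2$ with $$\int_{\mathbb R}P_{k_1,k_2}(x)\,x^l e^{-N(V(x)-ax)}\,dx=0\quad(0\le l<k_1),\qquad \int_{\mathbb R}P_{k_1,k_2}(x)\,x^l e^{-N(V(x)+ax)}\,dx=0\quad(0\le l<k_2);$$ it exists and is unique. Then there is a $3\times 3$ matrix $R(z)=R_{n_1,n_2}(z)$ of real polynomials such that the vector of wave functions $$\Psi(z)=\begin{pmatrix}P_{n_1,n_2}(z)\\ P_{n_1-1,n_2}(z)\\ P_{n_1,n_2-1}(z)\end{pmatrix}e^{-NV(z)}$$ satisfies $$\Psi'(z)=N\,R(z)\,\Psi(z),\qquad z\in\mathbb C,$$ and $$R(z)=-\begin{pmatrix}V'(z)&0&0\\0&a&0\\0&0&-a\end{pmatrix}+\begin{pmatrix}\mathcal O(z^{m-2})&\mathcal O(z^{m-2})&\mathcal O(z^{m-2})\\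 \mathcal O(z^{m-2})&\mathcal O(z^{m-3})&\mathcal O(z^{m-3})\\ \mathcal O(z^{m-2})&\mathcal O(z^{m-3})&\mathcal O(z^{m-3})\end{pmatrix},\qquad z\to\infty$$ (the constants $\mp a$ on the diagonal are absorbed by $\mathcal O(z^{m-3})$ when $m\ge 4$). Moreover $$\det(\xi I+R(z))=\xi^3+q_2(z)\xi^2+q_1(z)\xi+q_0(z)$$ with real polynomials $q_2,q_1,q_0$ that satisfy, with $\alpha=n_1/N$, $$q_2=-V',\qquad \deg q_1\le m-2,\qquad q_0(z)=v_ma^2z^{m-1}+\bigl(v_{m-1}a^2+v_ma(2\alpha-1)\bigr)z^{m-2}+(\text{terms of degree}<m-2).$$ -/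

import Mathlib

open Polynomial MeasureTheory Asymptotics

noncomputable section

namespace ExternalSource

/-- The real polynomial potential `V(z) = ∑_{k=1}^m (v_k / k) z^k`. -/
def potential (m : ℕ) (v : ℕ → ℝ) : ℝ[X] :=
  ∑ k ∈ Finset.Icc 1 m, C (v k / (k : ℝ)) * X ^ k

/-- The weight `e^{-N (V(x) - b x)}` on the real line. -/
def weight (V : ℝ[X]) (N : ℕ) (b : ℝ) (x : ℝ) : ℝ :=
  Real.exp (-(N : ℝ) * (V.eval x - b * x))

/-- `P` is a type II multiple orthogonal polynomial of multi-index `(k₁, k₂)` for the two weights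
`e^{-N (V(x) - a x)}` and `e^{-N (V(x) + a x)}`: it is monic of degree `k₁ + k₂`, and orthogonal to
`x^l` for `l < k₁` with respect to the first weight and for `l < k₂` with respect to the second.
The parameters `N` and `(k₁, k₂)` are independent. -/
structure IsMOP (V : ℝ[X]) (a : ℝ) (N k₁ k₂ : ℕ) (P : ℝ[X]) : Prop where
  monic : P.Monic
  natDegree_eq : P.natDegree = k₁ + k₂
  orthogonal_one : ∀ l < k₁, ∫ x : ℝ, P.eval x * x ^ l * weight V N a x = 0
  orthogonal_two : ∀ l < k₂, ∫ x : ℝ, P.eval x * x ^ l * weight V N (-a) x = 0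

/-- The vector of wave functions `(P₀(z), P₁(z), P₂(z))ᵀ e^{-N V(z)}`, `z ∈ ℂ`. -/
def waveVector (V : ℝ[X]) (N : ℕ) (P₀ P₁ P₂ : ℝ[X]) (z : ℂ) : Fin 3 → ℂ :=
  ![aeval z P₀ * Complex.exp (-(N : ℂ) * aeval z V),
    aeval z P₁ * Complex.exp (-(N : ℂ) * aeval z V),
    aeval z P₂ * Complex.exp (-(N : ℂ) * aeval z V)]

/-- The value at `z ∈ ℂ` of a matrix whose entries are real polynomials. -/
def evalMatrix (R : Matrix (Fin 3) (Fin 3) ℝ[X]) (z : ℂ) : Matrix (Fin 3) (Fin 3) ℂ :=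
  R.map (fun p => aeval z p)

/-- `p(z) = O(z^k)` as `z → ∞` in `ℂ`, for an integer `k` of any sign. -/
def IsOrder (p : ℝ[X]) (k : ℤ) : Prop :=
  (fun z : ℂ => aeval z p) =O[Bornology.cobounded ℂ] (fun z : ℂ => z ^ k)

/-- The diagonal matrix `D = diag(V', a, -a)`. -/
def diagD (V : ℝ[X]) (a : ℝ) : Matrix (Fin 3) (Fin 3) ℝ[X] :=
  Matrix.diagonal ![derivative V, C a, C (-a)]

/-- The orders `z^{m-2}` (first row and first column) and `z^{m-3}` (the other entries). -/
def entryOrder (m : ℕ) (i j : Fin 3) : ℤ :=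
  if i = 0 ∨ j = 0 then (m : ℤ) - 2 else (m : ℤ) - 3

/-- The polynomial `det(ξ I + R)` in `ξ`, whose coefficients are polynomials in `z`. -/
def spectralDet (R : Matrix (Fin 3) (Fin 3) ℝ[X]) : ℝ[X][X] :=
  ((X : ℝ[X][X]) • (1 : Matrix (Fin 3) (Fin 3) ℝ[X][X]) + R.map C).det

/-- The normalization of the coefficients of an admissible spectral curve
`ξ³ + p₂ ξ² + p₁ ξ + p₀ = 0` with potential `V` (coefficients `v`, degree `m ≥ 2`) and
parameters `a` and `α`. -/
structure IsNormalized (m : ℕ) (v : ℕ → ℝ) (a α : ℝ) (p₂ p₁ p₀ : ℝ[X]) : Prop where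
  p_two : p₂ = -derivative (potential m v)
  p_one : p₁.natDegree ≤ m - 2
  p_zero : (p₀ - (C (v m * a ^ 2) * X ^ (m - 1)
      + C (v (m - 1) * a ^ 2 + v m * a * (2 * α - 1)) * X ^ (m - 2))).degree < ((m - 2 : ℕ) : WithBot ℕ)

end ExternalSource

end

/-!
The proof is the formal version of the Riemann-Hilbert argument: Cauchy transforms are replaced by
formal Laurent series in `u = 1 / z`, so that only the moments of the two weights matter.

*Normality.* A polynomial `Q` that is orthogonal to `x ^ l` (`l < k₁`) for the first weight and to
`x ^ l` (`l < k₂`) for the second has at least `k₁ + k₂` real zeros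
(`RapidDecay.exists_zeros_of_orthogonal_pair`): `Q` times the second weight has a decaying primitive
of order `k₂`; this primitive, times the quotient `exp (2 * N * a * x)` of the weights, has a
decaying primitive of order `k₁`; and every differentiation gains a zero, by Rolle's theorem with
the two points at infinity counted as zeros. Hence the square linear system defining the multiple
orthogonal polynomials is injective, which gives existence and uniqueness. It also shows that
the first moments of `P_{n₁-1,n₂}` and `P_{n₁,n₂-1}` that are not required to vanish are nonzero.

*The differential equation.* Let `C₁`, `C₂` be the formal Cauchy transforms for the two weights,
suitably normalized, and let `Y` be the matrix with the rows `(Pᵢ, C₁ Pᵢ, C₂ Pᵢ)`. Orthogonality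
says `Y = Z * diag(z ^ N, z ^ (-n₁), z ^ (-n₂))` with `Z = 1 + O(1 / z)`, so that
`det Y = 1 + O(1 / z)`. Modulo polynomials `C₁` and `C₂` are linear over `ℝ[z]`, so `Y = A * B`
with a polynomial matrix `A` and a unipotent `B` that does not depend on the `Pᵢ`. Then
`det A = det Y` is a polynomial, hence it is `1`, and every matrix with rows `(Qᵢ, C₁ Qᵢ, C₂ Qᵢ)` is
a polynomial matrix times `Y` (`exists_mul_cauchyMatrix_eq`). Integration by parts shows that
`Y' / N - Y * diag(V', a, -a)` has this form, with `Qᵢ = Pᵢ' / N - V' Pᵢ`; the polynomial factor is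
`R`, and the first column is the system for the wave functions.

*Asymptotics.* In terms of `Z` the equation reads `R Z = Z T` with
`T = -diag(V' - 1/z, a + α/z, -a + (1 - α)/z) + O(1 / z ^ 2)`. The trace, the sum of the principal
`2 × 2` minors and the determinant of `R` are those of `T`
(`invariants_of_perturbed_diagonal`), and the entries of `R` are found by conjugating back
(`isO_entries_of_mul_eq`).
-/

/-! ### Rapidly decaying functions and Rolle's theorem on the line -/

section Analysis

open Polynomial MeasureTheory Filter Topology ExternalSource

/-- Continuous functions on `ℝ` that decay faster than every exponential. -/
structure RapidDecay (f : ℝ → ℝ) : Prop where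
  continuous : Continuous f
  bound : ∀ c : ℝ, ∃ C : ℝ, ∀ x, |f x| * Real.exp (c * |x|) ≤ C

namespace RapidDecay

variable {f g : ℝ → ℝ}

lemma add (hf : RapidDecay f) (hg : RapidDecay g) : RapidDecay (fun x => f x + g x) := by
  refine ⟨hf.continuous.add hg.continuous, fun c => ?_⟩
  obtain ⟨A, hA⟩ := hf.bound c
  obtain ⟨B, hB⟩ := hg.bound c
  refine ⟨A + B, fun x => ?_⟩
  calc |f x + g x| * Real.exp (c * |x|) ≤ (|f x| + |g x|) * Real.exp (c * |x|) := by
        gcongr; exact abs_add_le _ _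
    _ ≤ A + B := by rw [add_mul]; exact add_le_add (hA x) (hB x)

lemma mul_of_le_exp (hf : RapidDecay f) (hg : Continuous g) (K b : ℝ)
    (h : ∀ x, |g x| ≤ K * Real.exp (b * |x|)) : RapidDecay (fun x => f x * g x) := by
  refine ⟨hf.continuous.mul hg, fun c => ?_⟩
  obtain ⟨A, hA⟩ := hf.bound (b + c)
  have hK : 0 ≤ K := by simpa using (abs_nonneg _).trans (h 0)
  refine ⟨K * A, fun x => ?_⟩
  calc |f x * g x| * Real.exp (c * |x|)
      ≤ |f x| * (K * Real.exp (b * |x|)) * Real.exp (c * |x|) := by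
        rw [abs_mul]; gcongr; exact h x
    _ = K * (|f x| * Real.exp ((b + c) * |x|)) := by rw [add_mul, Real.exp_add]; ring
    _ ≤ K * A := by gcongr; exact hA x

lemma mul_exp (hf : RapidDecay f) (b : ℝ) : RapidDecay (fun x => f x * Real.exp (b * x)) := by
  refine hf.mul_of_le_exp (by fun_prop) 1 |b| fun x => ?_
  rw [Real.abs_exp, one_mul, ← abs_mul]
  exact Real.exp_le_exp.2 (le_abs_self _)

lemma mul_const (hf : RapidDecay f) (b : ℝ) : RapidDecay (fun x => f x * b) :=
  hf.mul_of_le_exp continuous_const |b| 0 fun x => by simp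

lemma mul_id (hf : RapidDecay f) : RapidDecay (fun x => f x * x) := by
  refine hf.mul_of_le_exp continuous_id 1 1 fun x => ?_
  rw [one_mul, one_mul]
  exact (le_add_of_nonneg_right zero_le_one).trans (Real.add_one_le_exp |x|)

lemma mul_pow (hf : RapidDecay f) (n : ℕ) : RapidDecay (fun x => f x * x ^ n) := by
  induction n with
  | zero => simpa using hf
  | succ n ih => simpa only [pow_succ, mul_assoc] using ih.mul_id

lemma mul_eval (hf : RapidDecay f) (p : ℝ[X]) : RapidDecay (fun x => f x * p.eval x) := by
  induction p using Polynomial.induction_on' with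
  | add p q hp hq => simpa only [eval_add, mul_add] using hp.add hq
  | monomial n a => simpa only [eval_monomial, mul_comm a, mul_assoc] using
      (hf.mul_pow n).mul_const a

lemma integrable (hf : RapidDecay f) : Integrable f := by
  obtain ⟨C, hC⟩ := hf.bound 1
  refine (integrable_inv_one_add_sq.const_mul (C * 2)).mono' hf.continuous.aestronglyMeasurable
    (ae_of_all _ fun x => ?_)
  have h1 : 1 + x ^ 2 ≤ 2 * Real.exp |x| := by
    have := Real.quadratic_le_exp_of_nonneg (abs_nonneg x)
    rw [sq_abs] at this
    nlinarith [abs_nonneg x]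
  have h2 := hC x
  rw [one_mul] at h2
  rw [Real.norm_eq_abs, ← div_eq_mul_inv, le_div_iff₀ (by positivity)]
  nlinarith [abs_nonneg (f x)]

lemma tendsto_zero (hf : RapidDecay f) {l : Filter ℝ} (hl : Tendsto (fun x : ℝ => |x|) l atTop) :
    Tendsto f l (𝓝 0) := by
  obtain ⟨C, hC⟩ := hf.bound 1
  have h : Tendsto (fun x : ℝ => C * Real.exp (-|x|)) l (𝓝 0) := by
    simpa using ((Real.tendsto_exp_neg_atTop_nhds_zero).comp hl).const_mul C
  refine squeeze_zero_norm (fun x => ?_) h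
  have := hC x
  rw [one_mul] at this
  rw [Real.norm_eq_abs, Real.exp_neg, ← div_eq_mul_inv, le_div_iff₀ (Real.exp_pos _)]
  exact this

/-- A rapidly decaying function of mean zero has a rapidly decaying primitive. -/
lemma exists_primitive (hf : RapidDecay f) (h0 : ∫ x, f x = 0) :
    ∃ F, RapidDecay F ∧ ∀ x, HasDerivAt F (f x) x := by
  have hi := hf.integrable
  have hd : ∀ x, HasDerivAt (fun x => ∫ t in Set.Iic x, f t) (f x) x := by
    intro x
    have h1 : (fun x => ∫ t in Set.Iic x, f t) =
        fun x => (∫ t in (0 : ℝ)..x, f t) + ∫ t in Set.Iic 0, f t := by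
      funext y
      rw [← intervalIntegral.integral_Iic_sub_Iic hi.integrableOn hi.integrableOn]
      ring
    rw [h1]
    exact (intervalIntegral.integral_hasDerivAt_right (hf.continuous.intervalIntegrable _ _)
      (hf.continuous.stronglyMeasurableAtFilter _ _) hf.continuous.continuousAt).add_const _
  refine ⟨fun x => ∫ t in Set.Iic x, f t, ⟨?_, fun c => ?_⟩, hd⟩
  · exact continuous_iff_continuousAt.2 fun x => (hd x).continuousAt
  have hg : RapidDecay (fun t => |f t| * Real.exp (|c| * |t|)) :=
    RapidDecay.mul_of_le_exp ⟨hf.continuous.abs, by simpa using hf.bound⟩ (by fun_prop) 1 |c|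
      fun x => by simp
  refine ⟨∫ t, |f t| * Real.exp (|c| * |t|), fun x => ?_⟩
  -- The tail of the integral on the side of `x` away from `0` carries the weight `exp (c * |x|)`.
  have key : ∀ s : Set ℝ, MeasurableSet s → (∀ t ∈ s, |x| ≤ |t|) →
      |∫ t in s, f t| * Real.exp (c * |x|) ≤ ∫ t, |f t| * Real.exp (|c| * |t|) := by
    intro s hs hst
    calc |∫ t in s, f t| * Real.exp (c * |x|)
        ≤ (∫ t in s, |f t|) * Real.exp (c * |x|) := by
          gcongr; exact abs_integral_le_integral_abs
      _ = ∫ t in s, |f t| * Real.exp (c * |x|) := (integral_mul_const _ _).symm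
      _ ≤ ∫ t in s, |f t| * Real.exp (|c| * |t|) := by
          refine setIntegral_mono_on (hi.abs.mul_const _).integrableOn hg.integrable.integrableOn hs
            fun t ht => ?_
          have : c * |x| ≤ |c| * |t| :=
            mul_le_mul (le_abs_self c) (hst t ht) (abs_nonneg _) (abs_nonneg _)
          gcongr
      _ ≤ ∫ t, |f t| * Real.exp (|c| * |t|) :=
          setIntegral_le_integral hg.integrable (ae_of_all _ fun t => by positivity)
  rcases le_total x 0 with hx | hx
  · refine key _ measurableSet_Iic fun t (ht : t ≤ x) => ?_
    rw [abs_of_nonpos hx, abs_of_nonpos (ht.trans hx)]; linarith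
  · have h2 : ∫ t in Set.Iic x, f t = -∫ t in Set.Ioi x, f t := by
      have := intervalIntegral.integral_Iic_add_Ioi (b := x) hi.integrableOn hi.integrableOn
      linarith
    simp only [h2, abs_neg]
    refine key _ measurableSet_Ioi fun t (ht : x < t) => ?_
    rw [abs_of_nonneg hx, abs_of_nonneg (hx.trans ht.le)]; exact ht.le

end RapidDecay

/-- Rolle's theorem on the whole line, with the two points at infinity counted as zeros: it is
the usual theorem for the continuous extension of `F` to `EReal`. -/
lemma exists_finset_zeros_deriv {F f : ℝ → ℝ} (hF : ∀ x, HasDerivAt F (f x) x)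
    (htop : Tendsto F atTop (𝓝 0)) (hbot : Tendsto F atBot (𝓝 0))
    (s : Finset ℝ) (hs : ∀ x ∈ s, F x = 0) :
    ∃ t : Finset ℝ, t.card = s.card + 1 ∧ ∀ x ∈ t, f x = 0 := by
  classical
  by_cases hfin : {x | f x = 0}.Finite
  swap
  · obtain ⟨t, ht, hc⟩ := Set.Infinite.exists_subset_card_eq hfin (s.card + 1)
    exact ⟨t, hc, fun x hx => ht hx⟩
  let e : ℝ ↪ EReal := ⟨fun x => (x : EReal), EReal.coe_injective⟩
  let G : EReal → ℝ := fun x => if x = ⊥ ∨ x = ⊤ then 0 else F x.toReal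
  have hGF : ∀ x : ℝ, G x = F x := fun x => by simp [G]
  have hG : Continuous G := by
    refine continuous_iff_continuousAt.2 fun x => ?_
    induction x with
    | bot =>
      intro U hU
      rw [show G ⊥ = 0 by simp [G]] at hU
      obtain ⟨b, hb⟩ := mem_atBot_sets.1 (hbot hU)
      refine EReal.mem_nhds_bot_iff.2 ⟨b, fun x hx => ?_⟩
      induction x with
      | bot => simpa [G] using mem_of_mem_nhds hU
      | top => simp at hx
      | coe x => simpa [hGF] using hb x (EReal.coe_lt_coe_iff.1 hx).le
    | top =>
      intro U hU
      rw [show G ⊤ = 0 by simp [G]] at hU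
      obtain ⟨b, hb⟩ := mem_atTop_sets.1 (htop hU)
      refine EReal.mem_nhds_top_iff.2 ⟨b, fun x hx => ?_⟩
      induction x with
      | top => simpa [G] using mem_of_mem_nhds hU
      | bot => simp at hx
      | coe x => simpa [hGF] using hb x (EReal.coe_lt_coe_iff.1 hx).le
    | coe x =>
      refine EReal.isOpenEmbedding_coe.continuousAt_iff.1 ?_
      rw [show G ∘ Real.toEReal = F from funext hGF]
      exact (hF x).continuousAt
  let S : Finset EReal := insert ⊥ (insert ⊤ (s.map e))
  have hS : S.card = s.card + 2 := by
    simp [S, e]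
  have hGS : ∀ x ∈ S, G x = 0 := by
    intro x hx
    simp only [S, Finset.mem_insert, Finset.mem_map] at hx
    rcases hx with rfl | rfl | ⟨y, hy, rfl⟩
    · simp [G]
    · simp [G]
    · exact (hGF y).trans (hs y hy)
  have hle : S.card ≤ (hfin.toFinset.map e).card + 1 := by
    refine Finset.card_le_of_interleaved fun x hx y hy hxy _ => ?_
    obtain ⟨c, hc, hext⟩ := exists_isLocalExtr_Ioo hxy hG.continuousOn
      ((hGS x hx).trans (hGS y hy).symm)
    lift c to ℝ using ⟨(hc.2.trans_le le_top).ne, (bot_le.trans_lt hc.1).ne'⟩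
    have hext' : IsLocalExtr F c := by
      have := hext.comp_continuous (g := Real.toEReal) (b := c)
        continuous_coe_real_ereal.continuousAt
      rwa [show G ∘ Real.toEReal = F from funext hGF] at this
    refine ⟨c, ?_, hc.1, hc.2⟩
    simpa [e] using hext'.hasDerivAt_eq_zero (hF c)
  rw [hS, Finset.card_map] at hle
  obtain ⟨t, ht, hc⟩ := Finset.exists_subset_card_eq (show s.card + 1 ≤ hfin.toFinset.card by omega)
  exact ⟨t, hc, fun x hx => by simpa using ht hx⟩

namespace RapidDecay

variable {f F : ℝ → ℝ}

/-- Integration by parts against the exponential polynomial `x ^ l * exp (c * x)`. -/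
lemma integral_primitive (hf : RapidDecay f) (hF : RapidDecay F) (hd : ∀ x, HasDerivAt F (f x) x)
    (c : ℝ) (l : ℕ) :
    (∫ x, f x * x ^ l * Real.exp (c * x)) + l * (∫ x, F x * x ^ (l - 1) * Real.exp (c * x))
      + c * (∫ x, F x * x ^ l * Real.exp (c * x)) = 0 := by
  have i1 := ((hf.mul_pow l).mul_exp c).integrable
  have i2 := ((hF.mul_pow (l - 1)).mul_exp c).integrable
  have i3 := ((hF.mul_pow l).mul_exp c).integrable
  have i12 : Integrable (fun x => f x * x ^ l * Real.exp (c * x)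
      + l * (F x * x ^ (l - 1) * Real.exp (c * x))) := i1.add (i2.const_mul _)
  rw [← integral_const_mul, ← integral_const_mul, ← integral_add i1 (i2.const_mul _),
    ← integral_add i12 (i3.const_mul _)]
  refine integral_eq_zero_of_hasDerivAt_of_integrable (f := fun x => F x * x ^ l * Real.exp (c * x))
    (fun x => ?_) (i12.add (i3.const_mul _)) i3
  have h1 : HasDerivAt (fun x : ℝ => Real.exp (c * x)) (Real.exp (c * x) * (c * 1)) x :=
    ((hasDerivAt_id x).const_mul c).exp
  refine (((hd x).mul (hasDerivAt_pow l x)).mul h1).congr_deriv ?_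
  simp only [Pi.mul_apply]
  ring

/-- A rapidly decaying function `f` orthogonal to `x ^ l`, `l < k`, has a rapidly decaying `k`-th
primitive `g`. It inherits the orthogonality to the exponential polynomials
`x ^ l * exp (c * x)`, `l < j`, because their span is closed under primitives. If every such `g`
has `n` zeros, then `f` has `n + k`, as each differentiation gains one. -/
lemma exists_zeros_of_orthogonal (k : ℕ) {f : ℝ → ℝ} (hf : RapidDecay f)
    {c : ℝ} (hc : c ≠ 0) (n j : ℕ)
    (hfin : ∀ g, RapidDecay g → (∀ l < j, ∫ x, g x * x ^ l * Real.exp (c * x) = 0) →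
      ∃ s : Finset ℝ, s.card = n ∧ ∀ x ∈ s, g x = 0)
    (h1 : ∀ l < k, ∫ x, f x * x ^ l = 0)
    (h2 : ∀ l < j, ∫ x, f x * x ^ l * Real.exp (c * x) = 0) :
    ∃ s : Finset ℝ, s.card = n + k ∧ ∀ x ∈ s, f x = 0 := by
  induction k generalizing f with
  | zero => exact hfin f hf h2
  | succ k ih =>
    obtain ⟨F, hF, hd⟩ := hf.exists_primitive (by simpa using h1 0 k.succ_pos)
    have o1 : ∀ l < k, ∫ x, F x * x ^ l = 0 := fun l hl => by
      have := hf.integral_primitive hF hd 0 (l + 1)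
      simp only [zero_mul, Real.exp_zero, mul_one, add_zero, h1 (l + 1) (by omega), zero_add,
        Nat.add_sub_cancel, mul_eq_zero, Nat.cast_eq_zero, Nat.add_one_ne_zero, false_or] at this
      exact this
    have o2 : ∀ l < j, ∫ x, F x * x ^ l * Real.exp (c * x) = 0 := fun l hl => by
      induction l with
      | zero =>
        have := hf.integral_primitive hF hd c 0
        rw [h2 0 hl] at this
        simpa [hc] using this
      | succ l ihl =>
        have := hf.integral_primitive hF hd c (l + 1)
        rw [h2 _ hl, Nat.add_sub_cancel, ihl (by omega)] at this
        simpa [hc] using this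
    obtain ⟨s, hs, hz⟩ := ih hF o1 o2
    obtain ⟨t, ht, hz'⟩ := exists_finset_zeros_deriv hd
      (hF.tendsto_zero tendsto_abs_atTop_atTop) (hF.tendsto_zero tendsto_abs_atBot_atTop) s hz
    exact ⟨t, by omega, hz'⟩

/-- The exponential polynomials `x ^ l` (`l < k`) and `x ^ l * exp (c * x)` (`l < j`) form a
Chebyshev system, in dual form: a rapidly decaying function orthogonal to all of them has at
least `j + k` zeros. -/
lemma exists_zeros_of_orthogonal_pair (hf : RapidDecay f) {c : ℝ} (hc : c ≠ 0) (k j : ℕ)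
    (h1 : ∀ l < k, ∫ x, f x * x ^ l = 0)
    (h2 : ∀ l < j, ∫ x, f x * x ^ l * Real.exp (c * x) = 0) :
    ∃ s : Finset ℝ, s.card = j + k ∧ ∀ x ∈ s, f x = 0 := by
  refine hf.exists_zeros_of_orthogonal k hc j j (fun g hg h => ?_) h1 h2
  obtain ⟨s, hs, hz⟩ := (hg.mul_exp c).exists_zeros_of_orthogonal j hc 0 0
    (fun _ _ _ => ⟨∅, by simp⟩) (fun l hl => by simpa only [mul_right_comm] using h l hl)
    (fun l hl => by simp at hl)
  exact ⟨s, by omega, fun x hx => by simpa using hz x hx⟩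

end RapidDecay

/-! ### Weights, moment functionals and normality -/

lemma exists_lower_bound_eval (W : ℝ[X]) (h0 : 0 < W.natDegree) (he : Even W.natDegree)
    (hl : 0 < W.leadingCoeff) : ∃ K, ∀ x, K ≤ W.eval x := by
  have htop := W.tendsto_atTop_of_leadingCoeff_nonneg (natDegree_pos_iff_degree_pos.1 h0) hl.le
  have hbot : Tendsto (fun x => W.eval x) atBot atTop := by
    have hd : (W.comp (-X)).natDegree = W.natDegree := by simp [natDegree_comp]
    have hc : (W.comp (-X)).leadingCoeff = W.leadingCoeff := by
      rw [leadingCoeff_comp (by simp)]; simp [he.neg_one_pow]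
    have := ((W.comp (-X)).tendsto_atTop_of_leadingCoeff_nonneg
      (natDegree_pos_iff_degree_pos.1 (hd ▸ h0)) (hc ▸ hl.le)).comp tendsto_neg_atBot_atTop
    simpa [Function.comp_def] using this
  obtain ⟨x₀, h⟩ := W.continuous.exists_forall_le
    (by rw [cocompact_eq_atBot_atTop]; exact hbot.sup htop)
  exact ⟨_, h⟩

lemma rapidDecay_weight (V : ℝ[X]) (h2 : 2 ≤ V.natDegree) (he : Even V.natDegree)
    (hl : 0 < V.leadingCoeff) {N : ℕ} (hN : 0 < N) (b : ℝ) : RapidDecay (weight V N b) := by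
  have hN' : (1 : ℝ) ≤ N := by exact_mod_cast hN
  have key : ∀ μ : ℝ, ∃ K, ∀ x, K + μ * x ≤ V.eval x := by
    intro μ
    have hlt : (C μ * X).natDegree < V.natDegree :=
      ((natDegree_C_mul_le μ X).trans natDegree_X_le).trans_lt (by omega)
    have hd : (V - C μ * X).natDegree = V.natDegree := natDegree_sub_eq_left_of_natDegree_lt hlt
    have hc : (V - C μ * X).leadingCoeff = V.leadingCoeff :=
      leadingCoeff_sub_of_degree_lt (degree_lt_degree hlt)
    obtain ⟨K, hK⟩ := exists_lower_bound_eval (V - C μ * X) (by omega) (hd ▸ he) (hc ▸ hl)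
    refine ⟨K, fun x => ?_⟩
    have := hK x
    simp only [eval_sub, eval_mul, eval_C, eval_X] at this
    linarith
  refine ⟨by unfold weight; fun_prop, fun c => ?_⟩
  obtain ⟨K₁, h1⟩ := key (|b| + |c|)
  obtain ⟨K₂, h2⟩ := key (-(|b| + |c|))
  refine ⟨Real.exp (-(N * min K₁ K₂)), fun x => ?_⟩
  rw [weight, Real.abs_exp, ← Real.exp_add, Real.exp_le_exp]
  have h3 : min K₁ K₂ + (|b| + |c|) * |x| ≤ V.eval x := by
    rcases abs_cases x with ⟨hx, _⟩ | ⟨hx, _⟩ <;> rw [hx]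
    · linarith [h1 x, min_le_left K₁ K₂]
    · linarith [h2 x, min_le_right K₁ K₂]
  have h4 : b * x ≤ |b| * |x| := (le_abs_self _).trans (abs_mul b x).le
  have h5 : c * |x| ≤ |c| * |x| := by gcongr; exact le_abs_self c
  have h6 : |c| * |x| ≤ N * (|c| * |x|) := le_mul_of_one_le_left (by positivity) hN'
  have h7 : (N : ℝ) * (min K₁ K₂ + |c| * |x|) ≤ N * (V.eval x - b * x) := by
    gcongr; linarith
  linarith

/-- The functional `Q ↦ ∫ Q w` of the weight `w = weight V N b`. -/
noncomputable def momentFunctional (V : ℝ[X]) (N : ℕ) (b : ℝ)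
    (hw : RapidDecay (weight V N b)) : ℝ[X] →ₗ[ℝ] ℝ where
  toFun Q := ∫ x, Q.eval x * weight V N b x
  map_add' P Q := by
    simp only [eval_add, mul_comm _ (weight V N b _), mul_add]
    exact integral_add (hw.mul_eval P).integrable (hw.mul_eval Q).integrable
  map_smul' r Q := by
    simp only [eval_smul, smul_eq_mul, mul_assoc, RingHom.id_apply]
    exact integral_const_mul _ _

section

variable {V : ℝ[X]} {N : ℕ} {a b : ℝ} (hw : RapidDecay (weight V N b))

lemma momentFunctional_apply (Q : ℝ[X]) :
    momentFunctional V N b hw Q = ∫ x, Q.eval x * weight V N b x := rfl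

lemma momentFunctional_X_pow_mul (l : ℕ) (Q : ℝ[X]) :
    momentFunctional V N b hw (X ^ l * Q) = ∫ x, Q.eval x * x ^ l * weight V N b x := by
  simp only [momentFunctional_apply, eval_mul, eval_pow, eval_X, mul_comm (_ ^ l)]

/-- The Pearson equation of the weight: total derivatives have integral zero. -/
lemma momentFunctional_derivative (Q : ℝ[X]) :
    momentFunctional V N b hw (derivative Q - C (N : ℝ) * (derivative V - C b) * Q) = 0 := by
  have hi := (hw.mul_eval Q).integrable
  have hi' := (hw.mul_eval (derivative Q - C (N : ℝ) * (derivative V - C b) * Q)).integrable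
  rw [momentFunctional_apply]
  simp only [mul_comm _ (weight V N b _)]
  refine integral_eq_zero_of_hasDerivAt_of_integrable (fun x => ?_) hi' hi
  have h1 : HasDerivAt (weight V N b)
      (weight V N b x * (-(N : ℝ) * ((derivative V).eval x - b * 1))) x :=
    (((V.hasDerivAt x).sub ((hasDerivAt_id x).const_mul b)).const_mul (-(N : ℝ))).exp
  refine (h1.mul (Q.hasDerivAt x)).congr_deriv ?_
  simp only [eval_sub, eval_mul, eval_C]
  ring

/-- Normality of the pair of weights: a polynomial of degree less than the number of its
orthogonality conditions vanishes. -/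
lemma eq_zero_of_orthogonal (hw : RapidDecay (weight V N (-a))) (hN : 0 < N) (ha : a ≠ 0)
    {k₁ k₂ : ℕ} {Q : ℝ[X]} (hQ : Q.degree < ((k₁ + k₂ : ℕ) : WithBot ℕ))
    (h1 : ∀ l < k₁, ∫ x, Q.eval x * x ^ l * weight V N a x = 0)
    (h2 : ∀ l < k₂, ∫ x, Q.eval x * x ^ l * weight V N (-a) x = 0) : Q = 0 := by
  have hc : (2 * N * a : ℝ) ≠ 0 := by
    have : (N : ℝ) ≠ 0 := by exact_mod_cast hN.ne'
    positivity
  -- The quotient of the two weights is the exponential `exp (2 * N * a * x)`.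
  have hww : ∀ x, weight V N (-a) x * Real.exp (2 * N * a * x) = weight V N a x := fun x => by
    rw [weight, weight, ← Real.exp_add]; congr 1; ring
  obtain ⟨s, hs, hz⟩ := (hw.mul_eval Q).exists_zeros_of_orthogonal_pair hc k₂ k₁
    (fun l hl => by rw [← h2 l hl]; congr 1; funext x; ring)
    (fun l hl => by rw [← h1 l hl]; congr 1; funext x; rw [← hww]; ring)
  by_contra hne
  have hcard := card_le_degree_of_subset_roots (p := Q) (Z := s) (fun x hx => by
    have := hz x hx
    rw [mul_eq_zero, or_iff_right (show weight V N (-a) x ≠ 0 from (Real.exp_pos _).ne')] at this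
    rwa [mem_roots hne])
  rw [← natDegree_lt_iff_degree_lt hne] at hQ
  omega

end

/-- The multiple orthogonal polynomials exist and are unique, because the square linear system
that determines them is injective. -/
lemma existsUnique_isMOP {V : ℝ[X]} {N : ℕ} {a : ℝ} (hw₁ : RapidDecay (weight V N a))
    (hw₂ : RapidDecay (weight V N (-a))) (hN : 0 < N) (ha : a ≠ 0) (k₁ k₂ : ℕ) :
    ∃! P : ℝ[X], IsMOP V a N k₁ k₂ P := by
  set n := k₁ + k₂ with hn
  let T : ℝ[X] →ₗ[ℝ] (Fin k₁ ⊕ Fin k₂ → ℝ) := LinearMap.pi (Sum.elim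
    (fun l => momentFunctional V N a hw₁ ∘ₗ LinearMap.mulLeft ℝ (X ^ (l : ℕ)))
    (fun l => momentFunctional V N (-a) hw₂ ∘ₗ LinearMap.mulLeft ℝ (X ^ (l : ℕ))))
  have hT : ∀ Q : ℝ[X], T Q = 0 ↔
      (∀ l < k₁, ∫ x, Q.eval x * x ^ l * weight V N a x = 0) ∧
      (∀ l < k₂, ∫ x, Q.eval x * x ^ l * weight V N (-a) x = 0) := fun Q => by
    simp [T, funext_iff, Fin.forall_iff, momentFunctional_X_pow_mul]
  have hinj : ∀ Q : ℝ[X], Q.degree < (n : WithBot ℕ) → T Q = 0 → Q = 0 := fun Q hQ h =>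
    eq_zero_of_orthogonal hw₂ hN ha hQ ((hT Q).1 h).1 ((hT Q).1 h).2
  have hsurj : Function.Surjective (T.domRestrict (degreeLT ℝ n)) := by
    refine (LinearMap.injective_iff_surjective_of_finrank_eq_finrank ?_).1 ?_
    · rw [(degreeLTEquiv ℝ n).finrank_eq]; simp [hn]
    · refine (injective_iff_map_eq_zero _).2 fun Q hQ => Subtype.ext ?_
      exact hinj Q (mem_degreeLT.1 Q.2) hQ
  obtain ⟨⟨Q, hQ⟩, hTQ⟩ := hsurj (T (X ^ n))
  replace hQ := mem_degreeLT.1 hQ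
  have hTQ' : T (X ^ n - Q) = 0 := by rw [map_sub, sub_eq_zero]; exact hTQ.symm
  have hm : (X ^ n - Q).Monic := by
    simpa [sub_eq_add_neg] using monic_X_pow_add (p := -Q) (n := n) (by rwa [degree_neg])
  have hdeg : (X ^ n - Q).natDegree = n := by
    have : (X ^ n - Q).degree = (n : WithBot ℕ) := by
      rw [degree_sub_eq_left_of_degree_lt (by rwa [degree_X_pow]), degree_X_pow]
    exact natDegree_eq_of_degree_eq_some this
  refine ⟨X ^ n - Q, ⟨hm, hdeg, ((hT _).1 hTQ').1, ((hT _).1 hTQ').2⟩, fun P hP => ?_⟩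
  refine sub_eq_zero.1 (hinj _ ?_ ?_)
  · have hd : P.degree = (X ^ n - Q).degree := by
      rw [degree_eq_natDegree hP.monic.ne_zero, degree_eq_natDegree hm.ne_zero, hdeg,
        hP.natDegree_eq]
    have := degree_sub_lt_left hd hP.monic.ne_zero (by rw [hP.monic, hm])
    rwa [degree_eq_natDegree hP.monic.ne_zero, hP.natDegree_eq] at this
  · rw [map_sub, hTQ', sub_zero]
    exact (hT P).2 ⟨hP.orthogonal_one, hP.orthogonal_two⟩

lemma derivative_potential_coeff (m : ℕ) (v : ℕ → ℝ) (k : ℕ) :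
    (derivative (potential m v)).coeff k = if k < m then v (k + 1) else 0 := by
  have h : ((k : ℝ) + 1) ≠ 0 := by positivity
  rw [coeff_derivative, potential, finsetSum_coeff]
  simp only [coeff_C_mul_X_pow]
  rw [Finset.sum_ite_eq]
  simp only [Finset.mem_Icc, Nat.succ_le_iff]
  split_ifs <;> first | omega | (push_cast; field_simp; done) | simp

lemma potential_coeff_self {m : ℕ} (hm : 0 < m) (v : ℕ → ℝ) :
    (potential m v).coeff m = v m / m := by
  rw [potential, finsetSum_coeff]
  simp only [coeff_C_mul_X_pow]
  rw [Finset.sum_ite_eq, if_pos (Finset.mem_Icc.2 ⟨hm, le_rfl⟩)]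

lemma natDegree_potential {m : ℕ} (hm : 0 < m) {v : ℕ → ℝ} (hv : v m ≠ 0) :
    (potential m v).natDegree = m := by
  refine natDegree_eq_of_le_of_coeff_ne_zero ?_ ?_
  · refine natDegree_sum_le_of_forall_le _ _ fun k hk => ?_
    exact (natDegree_C_mul_X_pow_le _ _).trans (Finset.mem_Icc.1 hk).2
  · rw [potential_coeff_self hm]
    have : (m : ℝ) ≠ 0 := by exact_mod_cast hm.ne'
    positivity

end Analysis

/-! ### Laurent series at infinity and formal Cauchy transforms -/

open Polynomial HahnSeries ExternalSource

/-- The embedding of `ℝ[z]` into the field of formal Laurent series in `u = 1 / z`, the expansion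
of a polynomial at infinity; `z` is `single (-1) 1`. -/
noncomputable def toLaurentInf : ℝ[X] →+* HahnSeries ℤ ℝ :=
  eval₂RingHom HahnSeries.C (single (-1) 1)

lemma toLaurentInf_coeff (p : ℝ[X]) (n : ℤ) :
    (toLaurentInf p).coeff n = if n ≤ 0 then p.coeff (-n).toNat else 0 := by
  induction p using Polynomial.induction_on' with
  | add p q hp hq =>
    rw [map_add, HahnSeries.coeff_add, hp, hq, Polynomial.coeff_add]
    split_ifs <;> simp
  | monomial k r =>
    have h : toLaurentInf (monomial k r) = single (-(k : ℤ)) r := by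
      rw [toLaurentInf, coe_eval₂RingHom, eval₂_monomial, single_pow]
      simp [HahnSeries.C_apply, single_mul_single]
    rw [h, coeff_single, coeff_monomial]
    split_ifs <;> first | rfl | omega

/-- `f = O(z ^ k)` for a formal Laurent series `f` in `u = 1 / z`: all coefficients of `u ^ n` with
`n < -k` vanish. -/
def IsO (f : HahnSeries ℤ ℝ) (k : ℤ) : Prop := ∀ n < -k, f.coeff n = 0

namespace IsO

variable {f g : HahnSeries ℤ ℝ} {k l : ℤ}

lemma iff_le_orderTop : IsO f k ↔ ((-k : ℤ) : WithTop ℤ) ≤ f.orderTop := by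
  rw [le_orderTop_iff_forall]
  simp only [IsO, WithTop.coe_lt_coe]

lemma mono (hf : IsO f k) (h : k ≤ l) : IsO f l := fun n hn => hf n (by omega)

lemma add (hf : IsO f k) (hg : IsO g k) : IsO (f + g) k := fun n hn => by
  rw [HahnSeries.coeff_add, hf n hn, hg n hn, add_zero]

lemma neg (hf : IsO f k) : IsO (-f) k := fun n hn => by rw [HahnSeries.coeff_neg, hf n hn, neg_zero]

lemma sub (hf : IsO f k) (hg : IsO g k) : IsO (f - g) k := sub_eq_add_neg f g ▸ hf.add hg.neg

lemma mul (hf : IsO f k) (hg : IsO g l) : IsO (f * g) (k + l) := by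
  rw [iff_le_orderTop] at *
  refine le_trans ?_ orderTop_add_le_mul
  rw [neg_add, WithTop.coe_add]
  exact add_le_add hf hg

lemma zero : IsO 0 k := fun _ _ => coeff_zero

lemma sum {ι : Type*} {s : Finset ι} {F : ι → HahnSeries ℤ ℝ} (h : ∀ i ∈ s, IsO (F i) k) :
    IsO (∑ i ∈ s, F i) k := by
  classical
  induction s using Finset.induction_on with
  | empty => simpa using zero
  | insert i s hi ih =>
    rw [Finset.sum_insert hi]
    exact (h i (s.mem_insert_self i)).add (ih fun j hj => h j (Finset.mem_insert_of_mem hj))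

lemma single (r : ℝ) : IsO (HahnSeries.single (-k) r) k := fun _ hn =>
  coeff_single_of_ne hn.ne

lemma const (r : ℝ) : IsO (HahnSeries.C r) 0 := single r

lemma of_natDegree_le {p : ℝ[X]} {n : ℕ} (h : p.natDegree ≤ n) : IsO (toLaurentInf p) n :=
  fun i hi => by
    rw [toLaurentInf_coeff, coeff_eq_zero_of_natDegree_lt (by omega), ite_self]

lemma coeff_eq_zero {p : ℝ[X]} (h : IsO (toLaurentInf p) k) {n : ℕ} (hn : k < n) :
    p.coeff n = 0 := by
  have := h (-n) (by omega)
  rwa [toLaurentInf_coeff, if_pos (by omega), neg_neg, Int.toNat_natCast] at this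

lemma eq_zero {p : ℝ[X]} (h : IsO (toLaurentInf p) k) (hk : k < 0) : p = 0 :=
  Polynomial.ext fun n => h.coeff_eq_zero (by omega)

lemma ofPowerSeries {g : PowerSeries ℝ} (h : PowerSeries.constantCoeff g = 0) :
    IsO (HahnSeries.ofPowerSeries ℤ ℝ g) (-1) := fun n hn => by
  rw [PowerSeries.coeff_coe]
  split_ifs with h0
  · rfl
  · obtain rfl : n = 0 := by omega
    simpa using h

lemma exists_powerSeries (hf : IsO f 0) :
    ∃ g : PowerSeries ℝ, HahnSeries.ofPowerSeries ℤ ℝ g = f := by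
  refine ⟨PowerSeries.mk fun n => f.coeff n, ?_⟩
  ext n
  rw [PowerSeries.coeff_coe]
  split_ifs with h
  · exact (hf n (by omega)).symm
  · rw [PowerSeries.coeff_mk, Int.natAbs_of_nonneg (by omega)]

end IsO

/-- The derivation `d / dz` on Laurent series in `u = 1 / z`: it maps `u ^ n` to
`-n u ^ (n + 1)`. -/
noncomputable def derivInf (f : HahnSeries ℤ ℝ) : HahnSeries ℤ ℝ :=
  ofSuppBddBelow (fun n => (1 - n) * f.coeff (n - 1)) ⟨f.order + 1, fun n hn => by
    by_contra h
    exact hn (mul_eq_zero_of_right _ (coeff_eq_zero_of_lt_order (by omega)))⟩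

lemma derivInf_coeff (f : HahnSeries ℤ ℝ) (n : ℤ) :
    (derivInf f).coeff n = (1 - n) * f.coeff (n - 1) := rfl

lemma derivInf_toLaurentInf (p : ℝ[X]) :
    derivInf (toLaurentInf p) = toLaurentInf (derivative p) := by
  ext n
  rw [derivInf_coeff, toLaurentInf_coeff, toLaurentInf_coeff]
  rcases lt_trichotomy n 1 with h | rfl | h
  · obtain ⟨k, rfl⟩ : ∃ k : ℕ, n = -k := ⟨(-n).toNat, by omega⟩
    rw [if_pos (by omega), if_pos (by omega), coeff_derivative,
      show (-(-(k : ℤ) - 1)).toNat = k + 1 by omega, show (-(-(k : ℤ))).toNat = k by omega]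
    push_cast
    ring
  · simp
  · rw [if_neg (by omega), if_neg (by omega), mul_zero]

/-- The product rule for the factor `z ^ d`, where `single 1 d` stands for `d / z`. -/
lemma derivInf_single_mul (d : ℤ) (f : HahnSeries ℤ ℝ) :
    derivInf (single (-d) 1 * f) = single (-d) 1 * (derivInf f + single 1 (d : ℝ) * f) := by
  ext n
  simp only [derivInf_coeff, coeff_single_mul, HahnSeries.coeff_add]
  rw [show n - 1 - -d = n - -d - 1 by ring]
  push_cast
  ring

/-- The derivative of a series `c + O(1 / z)` is `O(1 / z ^ 2)`. -/
lemma IsO.derivInf {f : HahnSeries ℤ ℝ} (hf : IsO f 0) : IsO (derivInf f) (-2) := fun n hn => by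
  rw [derivInf_coeff]
  rcases eq_or_ne n 1 with rfl | h
  · simp
  · rw [hf _ (by omega), mul_zero]

/-- The formal Cauchy transform `∑ k, lam (x ^ k * Q) z ^ (-k - 1)` of the polynomial `Q` with
respect to a moment functional `lam`. -/
noncomputable def cauchyTransform (lam : ℝ[X] →ₗ[ℝ] ℝ) (Q : ℝ[X]) : HahnSeries ℤ ℝ :=
  ofSuppBddBelow (fun n : ℤ => if 0 < n then lam (X ^ (n - 1).toNat * Q) else 0)
    ⟨0, fun n hn => by
    by_contra h
    exact hn (if_neg (by omega))⟩

section CauchyTransform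

variable (lam : ℝ[X] →ₗ[ℝ] ℝ)

lemma cauchyTransform_coeff (Q : ℝ[X]) (n : ℤ) : (cauchyTransform lam Q).coeff n =
    if 0 < n then lam (X ^ (n - 1).toNat * Q) else 0 := rfl

lemma cauchyTransform_add (P Q : ℝ[X]) :
    cauchyTransform lam (P + Q) = cauchyTransform lam P + cauchyTransform lam Q := by
  ext n
  simp only [HahnSeries.coeff_add, cauchyTransform_coeff, mul_add, map_add]
  split_ifs <;> simp

lemma cauchyTransform_C_mul (r : ℝ) (Q : ℝ[X]) :
    cauchyTransform lam (Polynomial.C r * Q) = HahnSeries.C r * cauchyTransform lam Q := by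
  ext n
  rw [HahnSeries.C_mul_eq_smul, HahnSeries.coeff_smul, cauchyTransform_coeff,
    cauchyTransform_coeff, mul_left_comm, ← Polynomial.smul_eq_C_mul, map_smul]
  split_ifs <;> simp

lemma toLaurentInf_C (r : ℝ) : toLaurentInf (Polynomial.C r) = HahnSeries.C r :=
  eval₂_C _ _

lemma toLaurentInf_X : toLaurentInf X = single (-1) 1 := eval₂_X _ _

lemma toLaurentInf_X_mul_cauchyTransform (Q : ℝ[X]) :
    toLaurentInf X * cauchyTransform lam Q =
      cauchyTransform lam (X * Q) + HahnSeries.C (lam Q) := by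
  ext n
  rw [toLaurentInf_X, coeff_single_mul, HahnSeries.coeff_add, cauchyTransform_coeff,
    cauchyTransform_coeff,
    HahnSeries.C_apply, coeff_single, one_mul]
  rcases lt_trichotomy n 0 with h | rfl | h
  · rw [if_neg (by omega), if_neg (by omega), if_neg (by omega), add_zero]
  · simp
  · obtain ⟨k, rfl⟩ : ∃ k : ℕ, n = k + 1 := ⟨(n - 1).toNat, by omega⟩
    rw [if_pos (by omega), if_pos (by omega), if_neg (by omega), add_zero,
      show ((k : ℤ) + 1 - -1 - 1).toNat = k + 1 by omega,
      show ((k : ℤ) + 1 - 1).toNat = k by omega, pow_succ, mul_assoc]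

/-- Modulo polynomials the Cauchy transform is linear over the ring of polynomials. -/
lemma exists_cauchyTransform_eq (Q : ℝ[X]) : ∃ p : ℝ[X],
    cauchyTransform lam Q = toLaurentInf Q * cauchyTransform lam 1 + toLaurentInf p := by
  induction Q using Polynomial.induction_on with
  | C r => exact ⟨0, by rw [← mul_one (Polynomial.C r), cauchyTransform_C_mul, mul_one,
      toLaurentInf_C, map_zero, add_zero]⟩
  | add P Q hP hQ =>
    obtain ⟨p, hp⟩ := hP
    obtain ⟨q, hq⟩ := hQ
    exact ⟨p + q, by rw [cauchyTransform_add, hp, hq, map_add, map_add]; ring⟩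
  | monomial n r ih =>
    obtain ⟨p, hp⟩ := ih
    refine ⟨X * p - Polynomial.C (lam (Polynomial.C r * X ^ n)), ?_⟩
    have h := toLaurentInf_X_mul_cauchyTransform lam (Polynomial.C r * X ^ n)
    rw [hp] at h
    rw [show Polynomial.C r * X ^ (n + 1) = X * (Polynomial.C r * X ^ n) by ring, map_sub,
      map_mul _ X, map_mul _ X, toLaurentInf_C]
    linear_combination -h

/-- A Pearson equation for the functional turns into a differential equation for the Cauchy
transform. -/
lemma derivInf_cauchyTransform {W : ℝ[X]} (h : ∀ Q, lam (derivative Q - W * Q) = 0) (Q : ℝ[X]) :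
    derivInf (cauchyTransform lam Q) = cauchyTransform lam (derivative Q - W * Q) := by
  ext n
  rw [derivInf_coeff, cauchyTransform_coeff, cauchyTransform_coeff]
  rcases lt_or_ge 0 n with hn | hn
  · obtain ⟨k, rfl⟩ : ∃ k : ℕ, n = k + 1 := ⟨(n - 1).toNat, by omega⟩
    rw [if_pos hn, show ((k : ℤ) + 1 - 1).toNat = k by omega]
    have h1 := h (X ^ k * Q)
    rw [derivative_mul, derivative_X_pow, show Polynomial.C (k : ℝ) * X ^ (k - 1) * Q
      + X ^ k * derivative Q - W * (X ^ k * Q) = (k : ℝ) • (X ^ (k - 1) * Q)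
      + X ^ k * (derivative Q - W * Q) by rw [Polynomial.smul_eq_C_mul]; ring, map_add,
      map_smul, smul_eq_mul] at h1
    rcases Nat.eq_zero_or_pos k with rfl | hk
    · simp at h1 ⊢
      linarith
    · rw [if_pos (by omega), show ((k : ℤ) + 1 - 1 - 1).toNat = k - 1 by omega]
      push_cast
      linarith
  · rw [if_neg (by omega), if_neg (by omega), mul_zero]

end CauchyTransform

/-! ### Matrices of Laurent series -/

lemma isO_one_apply {n : Type*} [DecidableEq n] (i j : n) :
    IsO ((1 : Matrix n n (HahnSeries ℤ ℝ)) i j) 0 := by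
  rw [Matrix.one_apply]
  split_ifs
  · exact IsO.const 1
  · exact IsO.zero

/-- A matrix `1 + O(1 / z)` has determinant `1 + O(1 / z)` and an inverse `1 + O(1 / z)`. -/
lemma exists_inverse_of_isO_sub_one {n : Type*} [Fintype n] [DecidableEq n]
    {Y : Matrix n n (HahnSeries ℤ ℝ)} (hY : ∀ i j, IsO (Y i j - (1 : Matrix n n _) i j) (-1)) :
    IsO (Y.det - 1) (-1) ∧ ∃ G : Matrix n n (HahnSeries ℤ ℝ), Y * G = 1 ∧ G * Y = 1 ∧
      ∀ i j, IsO (G i j - (1 : Matrix n n _) i j) (-1) := by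
  let φ := HahnSeries.ofPowerSeries ℤ ℝ
  let ε := PowerSeries.constantCoeff (R := ℝ)
  have hφ1 : (1 : Matrix n n (PowerSeries ℝ)).map φ = 1 := Matrix.map_one _ (map_zero _) (map_one _)
  have hε1 : (1 : Matrix n n (PowerSeries ℝ)).map ε = 1 := Matrix.map_one _ (map_zero _) (map_one _)
  have h0 : ∀ i j, IsO (Y i j) 0 := fun i j => by
    have := ((hY i j).mono (show (-1 : ℤ) ≤ 0 by omega)).add (isO_one_apply i j)
    rwa [sub_add_cancel] at this
  choose U' hU' using fun i j => (h0 i j).exists_powerSeries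
  let U : Matrix n n (PowerSeries ℝ) := Matrix.of U'
  have hU : U.map φ = Y := by ext1 i j; exact hU' i j
  have hUε : U.map ε = 1 := by
    ext i j
    have h1 := hY i j 0 (by omega)
    rw [← hU, ← hφ1, Matrix.map_apply, Matrix.map_apply, ← map_sub, PowerSeries.coeff_coe] at h1
    rw [← hε1, Matrix.map_apply, Matrix.map_apply, ← sub_eq_zero, ← map_sub]
    simpa using h1
  have hdet : ε U.det = 1 := by
    rw [RingHom.map_det, RingHom.mapMatrix_apply, hUε, Matrix.det_one]
  have hunit : IsUnit U.det := by
    rw [PowerSeries.isUnit_iff_constantCoeff]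
    exact hdet ▸ isUnit_one
  have hinv : (U⁻¹).map ε = 1 := by
    have := congrArg (fun A => A.map ε) (U.mul_nonsing_inv hunit)
    simpa only [Matrix.map_mul, hUε, one_mul, hε1] using this
  refine ⟨?_, (U⁻¹).map φ, ?_, ?_, fun i j => ?_⟩
  · rw [← hU, ← RingHom.mapMatrix_apply, ← RingHom.map_det, ← map_one φ, ← map_sub]
    exact IsO.ofPowerSeries (by rw [map_sub, map_one]; exact sub_eq_zero.2 hdet)
  · rw [← hU, ← Matrix.map_mul, U.mul_nonsing_inv hunit, hφ1]
  · rw [← hU, ← Matrix.map_mul, U.nonsing_inv_mul hunit, hφ1]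
  · rw [← hφ1, Matrix.map_apply, Matrix.map_apply, ← map_sub]
    refine IsO.ofPowerSeries ?_
    have := congrFun (congrFun hinv i) j
    rw [← hε1, Matrix.map_apply, Matrix.map_apply] at this
    rw [map_sub]
    exact sub_eq_zero.2 this

namespace Matrix

variable {R S : Type*} [CommRing R] [CommRing S]

/-- The sum of the principal `2 × 2` minors of a `3 × 3` matrix. -/
def secondMinorSum (M : Matrix (Fin 3) (Fin 3) R) : R :=
  (M 0 0 * M 1 1 - M 0 1 * M 1 0) + (M 0 0 * M 2 2 - M 0 2 * M 2 0)
    + (M 1 1 * M 2 2 - M 1 2 * M 2 1)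

lemma two_mul_secondMinorSum (M : Matrix (Fin 3) (Fin 3) R) :
    2 * M.secondMinorSum = M.trace ^ 2 - (M * M).trace := by
  simp only [secondMinorSum, trace_fin_three, mul_apply, Fin.sum_univ_three]
  ring

lemma secondMinorSum_map (φ : R →+* S) (M : Matrix (Fin 3) (Fin 3) R) :
    (M.map φ).secondMinorSum = φ M.secondMinorSum := by
  simp [secondMinorSum]

end Matrix

lemma spectralDet_eq (R : Matrix (Fin 3) (Fin 3) ℝ[X]) :
    ExternalSource.spectralDet R = X ^ 3 + Polynomial.C R.trace * X ^ 2
      + Polynomial.C R.secondMinorSum * X + Polynomial.C R.det := by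
  rw [ExternalSource.spectralDet, Matrix.det_fin_three, Matrix.det_fin_three,
    Matrix.trace_fin_three, Matrix.secondMinorSum]
  simp
  ring

lemma invariants_eq_of_mul_eq {K : Type*} [Field K] [CharZero K]
    {M T Y G : Matrix (Fin 3) (Fin 3) K} (hYG : Y * G = 1) (hGY : G * Y = 1) (h : M * Y = Y * T) :
    M.trace = T.trace ∧ M.secondMinorSum = T.secondMinorSum ∧ M.det = T.det := by
  have hM : M = Y * T * G := by rw [← h, mul_assoc, hYG, mul_one]
  have htr : M.trace = T.trace := by
    rw [hM, Matrix.trace_mul_comm, ← mul_assoc, hGY, one_mul]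
  have hM2 : M * M = Y * (T * T) * G := by
    rw [hM]
    calc Y * T * G * (Y * T * G) = Y * T * (G * Y) * T * G := by simp only [mul_assoc]
      _ = Y * (T * T) * G := by rw [hGY, mul_one]; simp only [mul_assoc]
  have htr2 : (M * M).trace = (T * T).trace := by
    rw [hM2, Matrix.trace_mul_comm, ← mul_assoc, hGY, one_mul]
  refine ⟨htr, ?_, ?_⟩
  · have h2 : (2 : K) ≠ 0 := two_ne_zero
    refine mul_left_cancel₀ h2 ?_
    rw [Matrix.two_mul_secondMinorSum, Matrix.two_mul_secondMinorSum, htr, htr2]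
  · have hdet : Y.det * G.det = 1 := by rw [← Matrix.det_mul, hYG, Matrix.det_one]
    rw [hM, Matrix.det_mul, Matrix.det_mul]
    linear_combination T.det * hdet

/-- The characteristic coefficients of the perturbed diagonal matrix
`-diag(w - 1/z, a + α/z, -a + β/z) + O(z⁻²)`, where `w = O(z ^ (m - 1))` and `α + β = 1`. -/
lemma invariants_of_perturbed_diagonal {m : ℤ} (hm : 2 ≤ m) {w : HahnSeries ℤ ℝ}
    (hw : IsO w (m - 1)) (a α β : ℝ) (hαβ : α + β = 1) {T : Matrix (Fin 3) (Fin 3) (HahnSeries ℤ ℝ)}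
    (hT : ∀ i j, IsO (T i j + Matrix.diagonal ![w - single 1 1,
      HahnSeries.C a + single 1 α, -HahnSeries.C a + single 1 β] i j) (-2)) :
    IsO (T.trace + w) (-2) ∧ IsO T.secondMinorSum (m - 2) ∧
      IsO (T.det - w * (HahnSeries.C (a ^ 2) + single 1 (a * (α - β)))) (m - 3) := by
  have hu : ∀ r : ℝ, IsO (single 1 r) (-1) := fun r => IsO.single (k := -1) r
  have hu2 : ∀ r s : ℝ, IsO (single 1 r * single 1 s) (-2) := fun r s => (hu r).mul (hu s)
  have hc : ∀ r : ℝ, IsO (HahnSeries.C r) 0 := IsO.const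
  set u : ℝ → HahnSeries ℤ ℝ := ⇑(single (Γ := ℤ) (R := ℝ) 1) with hudef
  set e : Fin 3 → Fin 3 → HahnSeries ℤ ℝ := fun i j => T i j + Matrix.diagonal ![w - u 1,
      HahnSeries.C a + u α, -HahnSeries.C a + u β] i j with he
  replace hT : ∀ i j, IsO (e i j) (-2) := hT
  have h00 : T 0 0 = e 0 0 - (w - u 1) := by simp [he]
  have h11 : T 1 1 = e 1 1 - (HahnSeries.C a + u α) := by simp [he]
  have h22 : T 2 2 = e 2 2 - (-HahnSeries.C a + u β) := by simp [he]
  have hoff : ∀ i j, i ≠ j → T i j = e i j := fun i j hij => by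
    simp [he, Matrix.diagonal_apply_ne _ hij]
  have hsum : u α + u β = u 1 := by rw [hudef, ← single_add, hαβ]
  have hd : u (a * (α - β)) = HahnSeries.C a * (u α - u β) := by
    rw [mul_sub (HahnSeries.C a), eq_sub_iff_add_eq, hudef, HahnSeries.C_apply, single_mul_single,
      single_mul_single, zero_add, ← single_add]
    congr 1
    ring
  -- The sizes of the corner entry and of the product of the two other diagonal entries; the latter
  -- is `-a² - a (α - β) / z` up to `t`.
  have hT00 : IsO (T 0 0) (m - 1) := by
    rw [h00]
    exact ((hT 0 0).mono (by omega)).sub (hw.sub ((hu 1).mono (by omega)))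
  set t : HahnSeries ℤ ℝ := T 1 1 * T 2 2 + HahnSeries.C (a ^ 2) + u (a * (α - β)) with ht
  have ht2 : IsO t (-2) := by
    have : t = e 1 1 * e 2 2 - e 1 1 * (-HahnSeries.C a + u β) - (HahnSeries.C a + u α) * e 2 2
        + u α * u β := by
      rw [ht, h11, h22, hd, map_pow]; ring
    rw [this]
    have hb : IsO (-HahnSeries.C a + u β) 0 := (hc a).neg.add ((hu β).mono (by omega))
    have ha : IsO (HahnSeries.C a + u α) 0 := (hc a).add ((hu α).mono (by omega))
    exact (((((hT 1 1).mul (hT 2 2)).mono (by omega)).sub (((hT 1 1).mul hb).mono (by omega))).sub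
      ((ha.mul (hT 2 2)).mono (by omega))).add (hu2 α β)
  have hprod : IsO (T 1 1 * T 2 2) 0 := by
    have : T 1 1 * T 2 2 = t - HahnSeries.C (a ^ 2) - u (a * (α - β)) := by rw [ht]; ring
    rw [this]
    exact ((ht2.mono (by omega)).sub (hc _)).sub ((hu _).mono (by omega))
  have hoff1 : ∀ i j, i ≠ j → IsO (T i j) (-2) := fun i j h => hoff i j h ▸ hT i j
  have hoff2 : ∀ i j k l, i ≠ j → k ≠ l → IsO (T i j * T k l) (-4) := fun i j k l h h' =>
    (hoff1 i j h).mul (hoff1 k l h')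
  have hdiag : IsO (T 1 1 + T 2 2) (-1) := by
    have : T 1 1 + T 2 2 = e 1 1 + e 2 2 - u α - u β := by rw [h11, h22]; ring
    rw [this]
    exact ((((hT 1 1).mono (by omega)).add ((hT 2 2).mono (by omega))).sub (hu α)).sub (hu β)
  have hT1 : IsO (T 1 1) 0 := by
    rw [h11]
    exact ((hT 1 1).mono (by omega)).sub ((hc a).add ((hu α).mono (by omega)))
  have hT2 : IsO (T 2 2) 0 := by
    rw [h22]
    exact ((hT 2 2).mono (by omega)).sub ((hc a).neg.add ((hu β).mono (by omega)))
  refine ⟨?_, ?_, ?_⟩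
  · have : T.trace + w = e 0 0 + e 1 1 + e 2 2 := by
      rw [Matrix.trace_fin_three, h00, h11, h22]; linear_combination -hsum
    rw [this]
    exact ((hT 0 0).add (hT 1 1)).add (hT 2 2)
  · have : T.secondMinorSum = T 0 0 * (T 1 1 + T 2 2) + T 1 1 * T 2 2 - T 0 1 * T 1 0
        - T 0 2 * T 2 0 - T 1 2 * T 2 1 := by rw [Matrix.secondMinorSum]; ring
    rw [this]
    exact (((((hT00.mul hdiag).mono (by omega)).add (hprod.mono (by omega))).sub
      ((hoff2 0 1 1 0 (by decide) (by decide)).mono (by omega))).sub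
      ((hoff2 0 2 2 0 (by decide) (by decide)).mono (by omega))).sub
      ((hoff2 1 2 2 1 (by decide) (by decide)).mono (by omega))
  · have hs : IsO (e 0 0 + u 1) (-1) := ((hT 0 0).mono (by omega)).add (hu 1)
    have : T.det - w * (HahnSeries.C (a ^ 2) + u (a * (α - β))) =
        (e 0 0 + u 1) * (T 1 1 * T 2 2) - w * t - T 0 0 * (T 1 2 * T 2 1)
        - T 2 2 * (T 0 1 * T 1 0) - T 1 1 * (T 0 2 * T 2 0)
        + T 0 1 * T 1 2 * T 2 0 + T 0 2 * (T 1 0 * T 2 1) := by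
      rw [ht, Matrix.det_fin_three]
      linear_combination (T 1 1 * T 2 2) * h00
    rw [this]
    exact (((((((hs.mul hprod).mono (by omega)).sub ((hw.mul ht2).mono (by omega))).sub
      ((hT00.mul (hoff2 1 2 2 1 (by decide) (by decide))).mono (by omega))).sub
      ((hT2.mul (hoff2 0 1 1 0 (by decide) (by decide))).mono (by omega))).sub
      ((hT1.mul (hoff2 0 2 2 0 (by decide) (by decide))).mono (by omega))).add
      (((hoff2 0 1 1 2 (by decide) (by decide)).mul (hoff1 2 0 (by decide))).mono (by omega))).add
      (((hoff1 0 2 (by decide)).mul (hoff2 1 0 2 1 (by decide) (by decide))).mono (by omega))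

/-- Conjugation by `1 + O(1 / z)` perturbs `-diag(w, a, -a) + O(1 / z)` by terms of the orders
`entryOrder`. -/
lemma isO_entries_of_mul_eq {m : ℕ} (hm : 2 ≤ m) {w : HahnSeries ℤ ℝ} (hw : IsO w (m - 1)) (a : ℝ)
    {M T Y G : Matrix (Fin 3) (Fin 3) (HahnSeries ℤ ℝ)} (hYG : Y * G = 1)
    (hY : ∀ i j, IsO (Y i j - (1 : Matrix _ _ (HahnSeries ℤ ℝ)) i j) (-1))
    (hG : ∀ i j, IsO (G i j - (1 : Matrix _ _ (HahnSeries ℤ ℝ)) i j) (-1))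
    (hT : ∀ i j, IsO (T i j + Matrix.diagonal ![w, HahnSeries.C a, -HahnSeries.C a] i j) (-1))
    (h : M * Y = Y * T) (i j : Fin 3) :
    IsO (M i j + Matrix.diagonal ![w, HahnSeries.C a, -HahnSeries.C a] i j) (entryOrder m i j) := by
  set d : Fin 3 → HahnSeries ℤ ℝ := ![w, HahnSeries.C a, -HahnSeries.C a] with hd
  set D := Matrix.diagonal d
  have hca := IsO.const a
  have hdd : ∀ i j, i ≠ j → IsO (d j - d i) (if i = 0 ∨ j = 0 then (m : ℤ) - 1 else 0) := by
    have h0 : ∀ i, i ≠ 0 → IsO (d i) 0 := fun i hi => by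
      fin_cases i
      · exact absurd rfl hi
      · exact hca
      · exact hca.neg
    intro i j hij
    split_ifs with h0'
    · have h1 : ∀ i, IsO (d i) (m - 1) := fun i => by
        rcases eq_or_ne i 0 with rfl | hi
        · exact hw
        · exact (h0 i hi).mono (by omega)
      exact (h1 j).sub (h1 i)
    · rw [not_or] at h0'
      exact (h0 j h0'.2).sub (h0 i h0'.1)
  have hoff : ∀ A : Matrix (Fin 3) (Fin 3) (HahnSeries ℤ ℝ),
      (∀ i j, IsO (A i j - (1 : Matrix _ _ (HahnSeries ℤ ℝ)) i j) (-1)) →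
      ∀ i j, IsO (A i j) (if i = j then 0 else -1) := fun A hA i j => by
    split_ifs with hij
    · have := ((hA i j).mono (show (-1 : ℤ) ≤ 0 by omega)).add (isO_one_apply i j)
      rwa [sub_add_cancel] at this
    · have := hA i j
      rwa [Matrix.one_apply_ne hij, sub_zero] at this
  have hent : -1 ≤ entryOrder m i j := by unfold entryOrder; split_ifs <;> omega
  -- `M + D` is the conjugate of the small matrix `T + D`, minus a commutator with `Y`.
  have key : M + D = Y * (T + D) * G - (Y * D - D * Y) * G := by
    have hM : M = Y * T * G := by rw [← h, mul_assoc, hYG, mul_one]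
    rw [hM, sub_mul, mul_add, add_mul, mul_assoc D Y G, hYG, mul_one]
    abel
  rw [← Matrix.add_apply, key, Matrix.sub_apply]
  refine IsO.sub ?_ ?_
  · refine IsO.mono ?_ hent
    rw [Matrix.mul_apply]
    refine IsO.sum fun k _ => ?_
    rw [Matrix.mul_apply, Finset.sum_mul]
    refine IsO.sum fun l _ => ?_
    refine (((hoff Y hY i l).mul (hT l k)).mul (hoff G hG k j)).mono ?_
    split_ifs <;> omega
  · rw [Matrix.mul_apply]
    refine IsO.sum fun k _ => ?_
    have hcomm : (Y * D - D * Y) i k = Y i k * (d k - d i) := by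
      rw [Matrix.sub_apply, Matrix.mul_diagonal, Matrix.diagonal_mul]; ring
    rw [hcomm]
    rcases eq_or_ne i k with rfl | hik
    · rw [sub_self, mul_zero, zero_mul]; exact IsO.zero
    · refine (((hoff Y hY i k).mul (hdd i k hik)).mul (hoff G hG k j)).mono ?_
      rw [if_neg hik, entryOrder]
      split_ifs with h1 h2 h3 h4 <;> grind

/-! ### The differential system for formal Cauchy transforms -/

/-- The rows `(Q, C₁ Q, C₂ Q)`, where `C₁`, `C₂` are the Cauchy transforms with respect to two
moment functionals. -/
noncomputable def cauchyMatrix (lam₁ lam₂ : ℝ[X] →ₗ[ℝ] ℝ) (Q : Fin 3 → ℝ[X]) :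
    Matrix (Fin 3) (Fin 3) (HahnSeries ℤ ℝ) :=
  Matrix.of fun i => ![toLaurentInf (Q i), cauchyTransform lam₁ (Q i), cauchyTransform lam₂ (Q i)]

/-- The unipotent matrix whose rows span, over the polynomials, all rows `(Q, C₁ Q, C₂ Q)`. -/
noncomputable def cauchyBasis (lam₁ lam₂ : ℝ[X] →ₗ[ℝ] ℝ) :
    Matrix (Fin 3) (Fin 3) (HahnSeries ℤ ℝ) :=
  !![1, cauchyTransform lam₁ 1, cauchyTransform lam₂ 1; 0, 1, 0; 0, 0, 1]

section

variable (lam₁ lam₂ : ℝ[X] →ₗ[ℝ] ℝ)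

lemma det_cauchyBasis : (cauchyBasis lam₁ lam₂).det = 1 := by
  simp [cauchyBasis, Matrix.det_fin_three]

lemma exists_cauchyMatrix_eq (Q : Fin 3 → ℝ[X]) : ∃ A : Matrix (Fin 3) (Fin 3) ℝ[X],
    (∀ i, A i 0 = Q i) ∧
      cauchyMatrix lam₁ lam₂ Q = A.map toLaurentInf * cauchyBasis lam₁ lam₂ := by
  choose p hp using exists_cauchyTransform_eq lam₁
  choose q hq using exists_cauchyTransform_eq lam₂
  refine ⟨Matrix.of fun i => ![Q i, p (Q i), q (Q i)], fun i => rfl, ?_⟩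
  ext1 i j
  rw [Matrix.mul_apply, Fin.sum_univ_three]
  fin_cases j
  · simp [cauchyMatrix, cauchyBasis]
  · simpa [cauchyMatrix, cauchyBasis] using hp (Q i)
  · simpa [cauchyMatrix, cauchyBasis] using hq (Q i)

/-- If `Y = cauchyMatrix P` has determinant `1 + O(1 / z)`, then the rows of `Y` form a basis of
the polynomial span of all rows `(Q, C₁ Q, C₂ Q)`. -/
lemma exists_mul_cauchyMatrix_eq {P : Fin 3 → ℝ[X]}
    (hdet : IsO ((cauchyMatrix lam₁ lam₂ P).det - 1) (-1)) (Q : Fin 3 → ℝ[X]) :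
    ∃ R : Matrix (Fin 3) (Fin 3) ℝ[X], (∀ i, ∑ j, R i j * P j = Q i) ∧
      R.map toLaurentInf * cauchyMatrix lam₁ lam₂ P = cauchyMatrix lam₁ lam₂ Q := by
  obtain ⟨A, hA0, hA⟩ := exists_cauchyMatrix_eq lam₁ lam₂ P
  obtain ⟨A', hA0', hA'⟩ := exists_cauchyMatrix_eq lam₁ lam₂ Q
  have hA1 : A.det = 1 := by
    rw [hA, Matrix.det_mul, det_cauchyBasis, mul_one, ← RingHom.mapMatrix_apply,
      ← RingHom.map_det, ← map_one toLaurentInf, ← map_sub] at hdet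
    exact sub_eq_zero.1 (hdet.eq_zero (by norm_num))
  have hR : A' * A.adjugate * A = A' := by
    rw [mul_assoc, Matrix.adjugate_mul, hA1, one_smul, mul_one]
  refine ⟨A' * A.adjugate, fun i => ?_, ?_⟩
  · have := congrFun (congrFun hR i) 0
    rw [hA0', Matrix.mul_apply] at this
    simpa only [hA0] using this
  · rw [hA, ← mul_assoc, ← Matrix.map_mul, hR, hA']

end

/-- The differential system in terms of moment functionals: `lam₁`, `lam₂` satisfy the Pearson
equations of the two weights, normalized so that the first nonzero moments of `P 1` and `P 2`
are `1`. -/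
lemma exists_differential_matrix {m : ℕ} (hm : 2 ≤ m) {W : ℝ[X]} (hW : W.natDegree ≤ m - 1)
    (a : ℝ) {n₁ n₂ N : ℕ} (hn₁ : 1 ≤ n₁) (hn₂ : 1 ≤ n₂) (hN : N = n₁ + n₂)
    {lam₁ lam₂ : ℝ[X] →ₗ[ℝ] ℝ}
    (hlam₁ : ∀ Q, lam₁ (derivative Q - Polynomial.C (N : ℝ) * (W - Polynomial.C a) * Q) = 0)
    (hlam₂ : ∀ Q, lam₂ (derivative Q - Polynomial.C (N : ℝ) * (W - Polynomial.C (-a)) * Q) = 0)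
    {P : Fin 3 → ℝ[X]} (hdeg : ∀ i, (P i).natDegree ≤ N)
    (hlead : ∀ i, (P i).coeff N = if i = 0 then 1 else 0)
    (horth₁ : ∀ i, ∀ l < n₁, lam₁ (X ^ l * P i) = if i = 1 ∧ l + 1 = n₁ then 1 else 0)
    (horth₂ : ∀ i, ∀ l < n₂, lam₂ (X ^ l * P i) = if i = 2 ∧ l + 1 = n₂ then 1 else 0) :
    ∃ R : Matrix (Fin 3) (Fin 3) ℝ[X],
      (∀ i, Polynomial.C (N : ℝ) * ∑ j, R i j * P j =
        derivative (P i) - Polynomial.C (N : ℝ) * W * P i) ∧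
      (∀ i j, IsO (toLaurentInf (R i j + Matrix.diagonal ![W, Polynomial.C a,
        Polynomial.C (-a)] i j)) (entryOrder m i j)) ∧
      R.trace = -W ∧ IsO (toLaurentInf R.secondMinorSum) (m - 2) ∧
      IsO (toLaurentInf R.det - toLaurentInf W * (HahnSeries.C (a ^ 2)
        + single 1 (a * (n₁ / N - n₂ / N)))) (m - 3) := by
  have hN0 : (N : ℝ) ≠ 0 := by
    have : N ≠ 0 := by omega
    exact_mod_cast this
  set Y := cauchyMatrix lam₁ lam₂ P with hY
  -- The powers of `z` that the columns of `Y` start with.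
  set d : Fin 3 → ℤ := ![(N : ℤ), -(n₁ : ℤ), -(n₂ : ℤ)] with hd
  set Z : Matrix (Fin 3) (Fin 3) (HahnSeries ℤ ℝ) :=
    Matrix.of fun i j => single (d j) 1 * Y i j with hZ
  have hYZ : ∀ i j, Y i j = single (-d j) 1 * Z i j := fun i j => by
    rw [hZ, Matrix.of_apply, ← mul_assoc, single_mul_single, neg_add_cancel, one_mul]
    exact (one_mul _).symm
  have hZ1 : ∀ i j, IsO (Z i j - (1 : Matrix _ _ (HahnSeries ℤ ℝ)) i j) (-1) := by
    intro i j n hn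
    have h1 : ((1 : Matrix (Fin 3) (Fin 3) (HahnSeries ℤ ℝ)) i j).coeff n =
        if i = j ∧ n = 0 then 1 else 0 := by
      rw [Matrix.one_apply]
      by_cases hij : i = j <;> simp [hij, HahnSeries.coeff_one]
    rw [HahnSeries.coeff_sub, h1, hZ, Matrix.of_apply, coeff_single_mul, one_mul, sub_eq_zero]
    have hcau : ∀ (lam : ℝ[X] →ₗ[ℝ] ℝ) (k : ℕ) (r : Fin 3), 1 ≤ k →
        (∀ i, ∀ l < k, lam (X ^ l * P i) = if i = r ∧ l + 1 = k then 1 else 0) →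
        (cauchyTransform lam (P i)).coeff (n - -(k : ℤ)) = if i = r ∧ n = 0 then 1 else 0 := by
      intro lam k r hk h
      rw [cauchyTransform_coeff]
      split_ifs with h2 h3 h3
      · rw [h i _ (by omega), if_pos ⟨h3.1, by omega⟩]
      · rw [h i _ (by omega), if_neg fun h4 => h3 ⟨h4.1, by omega⟩]
      · omega
      · rfl
    fin_cases j
    · change (toLaurentInf (P i)).coeff (n - N) = _
      rw [toLaurentInf_coeff, if_pos (by omega)]
      rcases eq_or_ne n 0 with rfl | h0
      · rw [show (-(0 - (N : ℤ))).toNat = N by omega, hlead]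
        simp
      · rw [coeff_eq_zero_of_natDegree_lt ((hdeg i).trans_lt (by omega)),
          if_neg fun h => h0 h.2]
    · exact hcau lam₁ n₁ 1 hn₁ horth₁
    · exact hcau lam₂ n₂ 2 hn₂ horth₂
  obtain ⟨hdet, G, hZG, hGZ, hG⟩ := exists_inverse_of_isO_sub_one hZ1
  have hdetY : Y.det = Z.det := by
    have h1 : Y = Z * Matrix.diagonal fun j => single (-d j) 1 := by
      ext1 i j; rw [Matrix.mul_diagonal, hYZ, mul_comm]
    rw [h1, Matrix.det_mul, Matrix.det_diagonal, Fin.prod_univ_three, single_mul_single,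
      single_mul_single, show -d 0 + -d 1 + -d 2 = 0 by simp [hd, hN], mul_one, mul_one]
    exact mul_one _
  obtain ⟨R, hR0, hR⟩ := exists_mul_cauchyMatrix_eq lam₁ lam₂ (by rw [← hY, hdetY]; exact hdet)
    (fun i => Polynomial.C (N : ℝ)⁻¹ * (derivative (P i) - Polynomial.C (N : ℝ) * W * P i))
  have hCN : Polynomial.C (N : ℝ) * Polynomial.C (N : ℝ)⁻¹ = 1 := by
    rw [← Polynomial.C_mul, mul_inv_cancel₀ hN0, Polynomial.C_1]
  set w := toLaurentInf W with hw
  have hwO : IsO w (m - 1) := by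
    have := IsO.of_natDegree_le hW
    rwa [Nat.cast_sub (by omega), Nat.cast_one] at this
  set b : Fin 3 → HahnSeries ℤ ℝ := ![w, HahnSeries.C a, -HahnSeries.C a] with hb
  -- The differential equation of the full matrix `Y`, from the Pearson equations.
  have hode : ∀ i j, (R.map toLaurentInf * Y) i j =
      HahnSeries.C (N : ℝ)⁻¹ * derivInf (Y i j) - Y i j * b j := by
    intro i j
    rw [hR]
    have hcau : ∀ (lam : ℝ[X] →ₗ[ℝ] ℝ) (c : ℝ),
        (∀ Q, lam (derivative Q - Polynomial.C (N : ℝ) * (W - Polynomial.C c) * Q) = 0) →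
        cauchyTransform lam
          (Polynomial.C (N : ℝ)⁻¹ * (derivative (P i) - Polynomial.C (N : ℝ) * W * P i)) =
        HahnSeries.C (N : ℝ)⁻¹ * derivInf (cauchyTransform lam (P i))
          - cauchyTransform lam (P i) * HahnSeries.C c := by
      intro lam c h
      rw [derivInf_cauchyTransform lam h, ← cauchyTransform_C_mul, mul_comm _ (HahnSeries.C c),
        ← cauchyTransform_C_mul, eq_sub_iff_add_eq, ← cauchyTransform_add]
      congr 1
      linear_combination (-Polynomial.C c * P i) * hCN
    fin_cases j
    · change toLaurentInf _ = HahnSeries.C (N : ℝ)⁻¹ * derivInf (toLaurentInf (P i)) -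
        toLaurentInf (P i) * w
      rw [derivInf_toLaurentInf, hw, ← toLaurentInf_C, ← map_mul, ← map_mul, ← map_sub]
      congr 1
      linear_combination (-W * P i) * hCN
    · exact hcau lam₁ a hlam₁
    · have := hcau lam₂ (-a) hlam₂
      rw [map_neg] at this
      exact this
  have hδ : ∀ j, HahnSeries.C (N : ℝ)⁻¹ * single (1 : ℤ) ((d j : ℤ) : ℝ) =
      single (1 : ℤ) ((d j : ℝ) / N) := fun j => by
    rw [HahnSeries.C_apply, single_mul_single, zero_add, inv_mul_eq_div]
  set E : Matrix (Fin 3) (Fin 3) (HahnSeries ℤ ℝ) :=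
    G * Matrix.of fun i j => HahnSeries.C (N : ℝ)⁻¹ * derivInf (Z i j) with hE
  set T := E - Matrix.diagonal fun j => b j - single (1 : ℤ) ((d j : ℝ) / N) with hT
  have hRZ : R.map toLaurentInf * Z = Z * T := by
    have h1 : Z * T = (Matrix.of fun i j => HahnSeries.C (N : ℝ)⁻¹ * derivInf (Z i j)) -
        Z * Matrix.diagonal fun j => b j - single (1 : ℤ) ((d j : ℝ) / N) := by
      rw [hT, mul_sub, hE, ← mul_assoc, hZG, one_mul]
    rw [h1]
    ext1 i j
    have h2 := hode i j
    rw [hYZ i j, derivInf_single_mul, Matrix.mul_apply] at h2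
    have h3 : (R.map toLaurentInf * Z) i j = single (d j) 1 *
        ∑ k, R.map toLaurentInf i k * Y k j := by
      rw [Matrix.mul_apply, Finset.mul_sum]
      refine Finset.sum_congr rfl fun k _ => ?_
      rw [hZ, Matrix.of_apply]; ring
    have h4 : (single (d j) 1 : HahnSeries ℤ ℝ) * single (-d j) 1 = 1 := by
      rw [single_mul_single, add_neg_cancel, one_mul]; rfl
    rw [h3, h2, Matrix.sub_apply, Matrix.of_apply, Matrix.mul_diagonal, ← hδ]
    linear_combination (HahnSeries.C (N : ℝ)⁻¹ * (derivInf (Z i j)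
      + single 1 (d j : ℝ) * Z i j) - Z i j * b j) * h4
  have hEO : ∀ i j, IsO (E i j) (-2) := fun i j => by
    rw [hE, Matrix.mul_apply]
    refine IsO.sum fun k _ => ?_
    have hG0 := ((hG i k).mono (show (-1 : ℤ) ≤ 0 by omega)).add (isO_one_apply i k)
    have hZ0 := ((hZ1 k j).mono (show (-1 : ℤ) ≤ 0 by omega)).add (isO_one_apply k j)
    rw [sub_add_cancel] at hG0 hZ0
    exact (hG0.mul ((IsO.const _).mul hZ0.derivInf)).mono (by omega)
  have hα : (n₁ / N + n₂ / N : ℝ) = 1 := by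
    rw [← add_div, hN, Nat.cast_add, div_self]
    rw [← Nat.cast_add, ← hN]; exact hN0
  have hdiag : (fun j => b j - single (1 : ℤ) ((d j : ℝ) / N)) = ![w - single 1 1,
      HahnSeries.C a + single 1 (n₁ / N : ℝ), -HahnSeries.C a + single 1 (n₂ / N : ℝ)] := by
    funext j
    fin_cases j
    · simp [hb, hd, hN0]
    · simp [hb, hd, neg_div, sub_neg_eq_add]
    · simp [hb, hd, neg_div, sub_neg_eq_add]
  have : CharZero (HahnSeries ℤ ℝ) :=
    charZero_of_injective_ringHom (f := HahnSeries.C) HahnSeries.C_injective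
  obtain ⟨i1, i2, i3⟩ := invariants_eq_of_mul_eq hZG hGZ hRZ
  obtain ⟨o1, o2, o3⟩ := invariants_of_perturbed_diagonal (m := m) (by omega) hwO a (n₁ / N)
    (n₂ / N) hα (T := T) (fun i j => by
      rw [hT, ← hdiag, Matrix.sub_apply, sub_add_cancel]; exact hEO i j)
  refine ⟨R, fun i => ?_, fun i j => ?_, ?_, ?_, ?_⟩
  · rw [hR0]
    linear_combination (derivative (P i) - Polynomial.C (N : ℝ) * W * P i) * hCN
  · have h5 : ∀ i j, IsO (T i j + Matrix.diagonal b i j) (-1) := fun i j => by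
      have h6 : T i j + Matrix.diagonal b i j = E i j
          + Matrix.diagonal (fun j => single (1 : ℤ) ((d j : ℝ) / N)) i j := by
        rw [hT, Matrix.sub_apply, ← Matrix.diagonal_sub, Matrix.sub_apply]; ring
      rw [h6]
      refine ((hEO i j).mono (by omega)).add ?_
      rw [Matrix.diagonal_apply]
      split_ifs
      · exact IsO.single (k := -1) _
      · exact IsO.zero
    have h7 := isO_entries_of_mul_eq hm hwO a hZG hZ1 hG h5 hRZ i j
    have h8 : toLaurentInf (Matrix.diagonal ![W, Polynomial.C a, Polynomial.C (-a)] i j) =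
        Matrix.diagonal b i j := by
      rw [Matrix.diagonal_apply, Matrix.diagonal_apply]
      split_ifs
      · fin_cases i
        · rfl
        · exact toLaurentInf_C a
        · exact (toLaurentInf_C (-a)).trans (map_neg _ _)
      · exact map_zero _
    rw [map_add, h8]
    exact h7
  · have h8 : toLaurentInf (R.trace + W) = T.trace + w := by
      rw [map_add, ← i1, Matrix.trace_fin_three, Matrix.trace_fin_three, map_add, map_add]
      rfl
    exact eq_neg_of_add_eq_zero_left ((h8 ▸ o1 : IsO _ _).eq_zero (by norm_num))
  · rwa [← Matrix.secondMinorSum_map, i2]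
  · rwa [RingHom.map_det, RingHom.mapMatrix_apply, i3]

/-! ### Wave functions and the spectral curve -/

/-- For a polynomial the formal order at infinity bounds its growth. -/
lemma isOrder_of_isO {p : ℝ[X]} {k : ℤ} (h : IsO (toLaurentInf p) k) : IsOrder p k := by
  have h1 : (fun z : ℂ => aeval z p) = fun z : ℂ => ∑ i ∈ p.support, (p.coeff i : ℂ) * z ^ i := by
    funext z
    rw [aeval_def, eval₂_eq_sum, Polynomial.sum]
    rfl
  rw [IsOrder, h1]
  refine Asymptotics.IsBigO.fun_sum fun i hi => Asymptotics.IsBigO.const_mul_left ?_ _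
  have hik : (i : ℤ) ≤ k := by
    by_contra hlt
    exact (mem_support_iff.1 hi) (h.coeff_eq_zero (by omega))
  have h2 : ∀ᶠ z : ℂ in Bornology.cobounded ℂ, 1 ≤ ‖z‖ :=
    tendsto_norm_cobounded_atTop.eventually_ge_atTop 1
  refine Asymptotics.IsBigO.of_bound 1 ?_
  filter_upwards [h2] with z hz
  rw [one_mul, norm_zpow, norm_pow, ← zpow_natCast]
  exact zpow_le_zpow_right₀ hz hik

/-- A polynomial `q = V' (r + s / z) + O(z ^ (m - 3))` has the two leading coefficients `v m * r`
and `v (m - 1) * r + v m * s`. -/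
lemma degree_sub_lt_of_isO {m : ℕ} (hm : 2 ≤ m) (v : ℕ → ℝ) (r s : ℝ) {q : ℝ[X]}
    (h : IsO (toLaurentInf q - toLaurentInf (derivative (potential m v))
      * (HahnSeries.C r + single 1 s)) (m - 3)) :
    (q - (Polynomial.C (v m * r) * X ^ (m - 1)
      + Polynomial.C (v (m - 1) * r + v m * s) * X ^ (m - 2))).degree
      < ((m - 2 : ℕ) : WithBot ℕ) := by
  rw [degree_lt_iff_coeff_zero]
  intro k hk
  have h1 := h (-(k : ℤ)) (by omega)
  rw [mul_add, HahnSeries.coeff_sub, HahnSeries.coeff_add, mul_comm _ (HahnSeries.C r),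
    HahnSeries.C_mul_eq_smul, HahnSeries.coeff_smul, mul_comm _ (single 1 s), coeff_single_mul,
    toLaurentInf_coeff, toLaurentInf_coeff, toLaurentInf_coeff, if_pos (by omega),
    if_pos (by omega), if_pos (by omega), show (-(-(k : ℤ))).toNat = k by omega,
    show (-(-(k : ℤ) - 1)).toNat = k + 1 by omega, derivative_potential_coeff,
    derivative_potential_coeff, smul_eq_mul] at h1
  rw [Polynomial.coeff_sub, Polynomial.coeff_add, coeff_C_mul_X_pow, coeff_C_mul_X_pow]
  rcases eq_or_ne k (m - 2) with rfl | h2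
  · rw [if_pos (by omega), if_pos (by omega), show m - 2 + 1 + 1 = m by omega,
      show m - 2 + 1 = m - 1 by omega] at h1
    rw [if_neg (by omega), if_pos rfl]
    linarith
  · rw [if_neg (show ¬k + 1 < m by omega)] at h1
    rw [if_neg h2]
    rcases eq_or_ne k (m - 1) with rfl | h3
    · rw [if_pos (by omega), show m - 1 + 1 = m by omega] at h1
      rw [if_pos rfl]
      linarith
    · rw [if_neg (by omega)] at h1
      rw [if_neg h3]
      linarith

/-- The derivative of `Pᵢ * exp (-N * V)` is `(Pᵢ' - N * V' * Pᵢ) * exp (-N * V)`, so the system for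
the wave functions is a polynomial identity. -/
lemma hasDerivAt_waveVector (V : ℝ[X]) {N : ℕ} {P : Fin 3 → ℝ[X]}
    {R : Matrix (Fin 3) (Fin 3) ℝ[X]}
    (h : ∀ i, Polynomial.C (N : ℝ) * ∑ j, R i j * P j =
      derivative (P i) - Polynomial.C (N : ℝ) * derivative V * P i) (z : ℂ) :
    HasDerivAt (waveVector V N (P 0) (P 1) (P 2))
      ((N : ℂ) • (evalMatrix R z).mulVec (waveVector V N (P 0) (P 1) (P 2) z)) z := by
  have hw : waveVector V N (P 0) (P 1) (P 2) =
      fun z i => aeval z (P i) * Complex.exp (-(N : ℂ) * aeval z V) := by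
    funext z i
    fin_cases i <;> rfl
  rw [hw, hasDerivAt_pi]
  intro i
  have h1 : HasDerivAt (fun z : ℂ => Complex.exp (-(N : ℂ) * aeval z V))
      (Complex.exp (-(N : ℂ) * aeval z V) * (-(N : ℂ) * aeval z (derivative V))) z :=
    ((V.hasDerivAt_aeval z).const_mul _).cexp
  refine (((P i).hasDerivAt_aeval z).mul h1).congr_deriv ?_
  have h2 := congrArg (aeval z) (h i)
  simp only [map_mul, map_sub, map_sum, map_natCast] at h2
  have h3 : (evalMatrix R z).mulVec
      (fun i => aeval z (P i) * Complex.exp (-(N : ℂ) * aeval z V)) i =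
      (∑ j, aeval z (R i j) * aeval z (P j)) * Complex.exp (-(N : ℂ) * aeval z V) := by
    rw [Matrix.mulVec, dotProduct, Finset.sum_mul]
    exact Finset.sum_congr rfl fun j _ => (mul_assoc _ _ _).symm
  rw [Pi.smul_apply, smul_eq_mul, h3]
  linear_combination -Complex.exp (-(N : ℂ) * aeval z V) * h2

theorem theoremD (m : ℕ) (hm : Even m) (hm2 : 2 ≤ m) (v : ℕ → ℝ) (hv : 0 < v m)
    (a : ℝ) (ha : 0 < a) (n₁ n₂ : ℕ) (hn₁ : 1 ≤ n₁) (hn₂ : 1 ≤ n₂) :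
    -- the multiple orthogonal polynomials exist and are unique
    (∀ k₁ k₂ : ℕ, ∃! P : Polynomial ℝ,
      ExternalSource.IsMOP (ExternalSource.potential m v) a (n₁ + n₂) k₁ k₂ P) ∧
    ∀ P₀ P₁ P₂ : Polynomial ℝ,
      ExternalSource.IsMOP (ExternalSource.potential m v) a (n₁ + n₂) n₁ n₂ P₀ →
      ExternalSource.IsMOP (ExternalSource.potential m v) a (n₁ + n₂) (n₁ - 1) n₂ P₁ →
      ExternalSource.IsMOP (ExternalSource.potential m v) a (n₁ + n₂) n₁ (n₂ - 1) P₂ →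
      ∃ R : Matrix (Fin 3) (Fin 3) (Polynomial ℝ),
        -- the differential equation
        (∀ z : ℂ, HasDerivAt
          (ExternalSource.waveVector (ExternalSource.potential m v) (n₁ + n₂) P₀ P₁ P₂)
          (((n₁ + n₂ : ℕ) : ℂ) • Matrix.mulVec (ExternalSource.evalMatrix R z)
            (ExternalSource.waveVector (ExternalSource.potential m v) (n₁ + n₂) P₀ P₁ P₂ z)) z) ∧
        -- the orders of the entries
        (∀ i j : Fin 3, ExternalSource.IsOrder
          (R i j + ExternalSource.diagD (ExternalSource.potential m v) a i j)
          (ExternalSource.entryOrder m i j)) ∧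
        -- the characteristic polynomial
        ∃ q₂ q₁ q₀ : Polynomial ℝ,
          ExternalSource.spectralDet R =
            Polynomial.X ^ 3 + Polynomial.C q₂ * Polynomial.X ^ 2
              + Polynomial.C q₁ * Polynomial.X + Polynomial.C q₀ ∧
          ExternalSource.IsNormalized m v a ((n₁ : ℝ) / ((n₁ + n₂ : ℕ) : ℝ)) q₂ q₁ q₀ := by
  have hN : 0 < n₁ + n₂ := by omega
  have hVdeg := natDegree_potential (show 0 < m by omega) hv.ne'
  have hVlead : 0 < (potential m v).leadingCoeff := by
    rw [Polynomial.leadingCoeff, hVdeg, potential_coeff_self (by omega)]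
    positivity
  have hw : ∀ b, RapidDecay (weight (potential m v) (n₁ + n₂) b) :=
    rapidDecay_weight _ (by omega) (by rwa [hVdeg]) hVlead hN
  refine ⟨existsUnique_isMOP (hw a) (hw (-a)) hN ha.ne', fun P₀ P₁ P₂ hP₀ hP₁ hP₂ => ?_⟩
  set V := potential m v with hV
  set N := n₁ + n₂ with hNdef
  set mu₁ := momentFunctional V N a (hw a)
  set mu₂ := momentFunctional V N (-a) (hw (-a))
  have hmu₁ : ∀ l Q, mu₁ (X ^ l * Q) = ∫ x, Q.eval x * x ^ l * weight V N a x :=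
    momentFunctional_X_pow_mul (hw a)
  have hmu₂ : ∀ l Q, mu₂ (X ^ l * Q) = ∫ x, Q.eval x * x ^ l * weight V N (-a) x :=
    momentFunctional_X_pow_mul (hw (-a))
  -- By normality the first moment that is not required to vanish is nonzero.
  have h₁ : mu₁ (X ^ (n₁ - 1) * P₁) ≠ 0 := fun h0 => by
    refine hP₁.monic.ne_zero (eq_zero_of_orthogonal (k₁ := n₁) (k₂ := n₂) (hw (-a)) hN ha.ne' ?_
      (fun l hl => ?_) hP₁.orthogonal_two)
    · rw [degree_eq_natDegree hP₁.monic.ne_zero, hP₁.natDegree_eq]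
      exact_mod_cast (by omega : n₁ - 1 + n₂ < n₁ + n₂)
    · rcases eq_or_ne l (n₁ - 1) with rfl | h
      · rw [← hmu₁, h0]
      · exact hP₁.orthogonal_one l (by omega)
  have h₂ : mu₂ (X ^ (n₂ - 1) * P₂) ≠ 0 := fun h0 => by
    refine hP₂.monic.ne_zero (eq_zero_of_orthogonal (k₁ := n₁) (k₂ := n₂) (hw (-a)) hN ha.ne' ?_
      hP₂.orthogonal_one (fun l hl => ?_))
    · rw [degree_eq_natDegree hP₂.monic.ne_zero, hP₂.natDegree_eq]
      exact_mod_cast (by omega : n₁ + (n₂ - 1) < n₁ + n₂)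
    · rcases eq_or_ne l (n₂ - 1) with rfl | h
      · rw [← hmu₂, h0]
      · exact hP₂.orthogonal_two l (by omega)
  set P : Fin 3 → ℝ[X] := ![P₀, P₁, P₂] with hP
  have hW : (derivative V).natDegree ≤ m - 1 := (natDegree_derivative_le V).trans (by omega)
  obtain ⟨R, hR, hent, htr, hq1, hq0⟩ := exists_differential_matrix hm2 hW a hn₁ hn₂ hNdef
    (lam₁ := (mu₁ (X ^ (n₁ - 1) * P₁))⁻¹ • mu₁) (lam₂ := (mu₂ (X ^ (n₂ - 1) * P₂))⁻¹ • mu₂)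
    (P := P)
    (fun Q => by
      rw [LinearMap.smul_apply, momentFunctional_derivative (hw a) Q, smul_zero])
    (fun Q => by
      rw [LinearMap.smul_apply, momentFunctional_derivative (hw (-a)) Q, smul_zero])
    (fun i => by
      fin_cases i
      · exact hP₀.natDegree_eq.le
      · exact hP₁.natDegree_eq.le.trans (by omega)
      · exact hP₂.natDegree_eq.le.trans (by omega))
    (fun i => by
      fin_cases i
      · exact (hP₀.natDegree_eq ▸ hP₀.monic.coeff_natDegree :)
      · exact coeff_eq_zero_of_natDegree_lt (hP₁.natDegree_eq.le.trans_lt (by omega))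
      · exact coeff_eq_zero_of_natDegree_lt (hP₂.natDegree_eq.le.trans_lt (by omega)))
    (fun i l hl => by
      rw [LinearMap.smul_apply, smul_eq_mul]
      fin_cases i
      · change _ * mu₁ (X ^ l * P₀) = 0
        rw [hmu₁ l P₀, hP₀.orthogonal_one l hl, mul_zero]
      · change _ * mu₁ (X ^ l * P₁) = if (1 : Fin 3) = 1 ∧ l + 1 = n₁ then 1 else 0
        rcases eq_or_ne (l + 1) n₁ with h | h
        · rw [if_pos ⟨rfl, h⟩, show l = n₁ - 1 by omega, inv_mul_cancel₀ h₁]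
        · rw [if_neg fun h' => h h'.2, hmu₁ l P₁, hP₁.orthogonal_one l (by omega), mul_zero]
      · change _ * mu₁ (X ^ l * P₂) = 0
        rw [hmu₁ l P₂, hP₂.orthogonal_one l hl, mul_zero])
    (fun i l hl => by
      rw [LinearMap.smul_apply, smul_eq_mul]
      fin_cases i
      · change _ * mu₂ (X ^ l * P₀) = 0
        rw [hmu₂ l P₀, hP₀.orthogonal_two l hl, mul_zero]
      · change _ * mu₂ (X ^ l * P₁) = 0
        rw [hmu₂ l P₁, hP₁.orthogonal_two l hl, mul_zero]
      · change _ * mu₂ (X ^ l * P₂) = if (2 : Fin 3) = 2 ∧ l + 1 = n₂ then 1 else 0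
        rcases eq_or_ne (l + 1) n₂ with h | h
        · rw [if_pos ⟨rfl, h⟩, show l = n₂ - 1 by omega, inv_mul_cancel₀ h₂]
        · rw [if_neg fun h' => h h'.2, hmu₂ l P₂, hP₂.orthogonal_two l (by omega), mul_zero])
  refine ⟨R, hasDerivAt_waveVector V hR, fun i j => isOrder_of_isO (hent i j),
    R.trace, R.secondMinorSum, R.det, spectralDet_eq R, htr, ?_, ?_⟩
  · refine natDegree_le_iff_coeff_eq_zero.2 fun k hk => hq1.coeff_eq_zero (by omega)
  · have hα : a * ((n₁ : ℝ) / N - n₂ / N) = a * (2 * (n₁ / N) - 1) := by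
      have hN' : (N : ℝ) ≠ 0 := by exact_mod_cast hN.ne'
      rw [hNdef] at hN' ⊢
      push_cast at hN' ⊢
      field_simp
      ring
    rw [hα] at hq0
    have := degree_sub_lt_of_isO hm2 v _ _ hq0
    rwa [← mul_assoc] at this
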